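/- Let $p$ be a prime, let $\mathbb F$ be an algebraically closed field of characteristic $p$, and let $G$ be a finite group. Characters of group algebras over $\mathbb F$ are Brauer characters, defined by means of a fixed embedding of the torsion unit group of $\mathbb F$ into the torsion unit group of an algebraically closed field of characteristic $0$; $\mathrm{Irr}(\mathbb F H)$ is the set of irreducible $\mathbb F H$-characters, and $V(\xi)$ is a simple $\mathbb F H$-module with Brauer character $\xi\in\mathrm{Irr}(\mathbb F H)$ (unique up to isomorphism). For modules $L$, $M$ with $L$ indecomposable, $m(L,M)$ is the multiplicity of $L$ as a direct summand of $M$. If a finite $p$-group $S$ acts by automorphisms on a finite group $K$ and $\eta\in\mathrm{Irr}(\mathbb F K)$, then $\eta_{\rtimes S}$ denotes the unique irreducible $\mathbb F(K\rtimes S)$-character such that the restriction of $V(\eta_{\rtimes S})$ to $K$ is a direct sum of mutually non-isomorphic $S$-conjugates of $V(\eta)$. A piece $Q_\phi$ of $\mathbb F G$ consists of a $p$-subgroup $Q$ of $G$ and a character $\phi\in\mathrm{Irr}(\mathbb F C_G(Q))$; $G$ permutes the pieces by conjugation. For a $p$-subgroup $P$ of $G$ and a piece $Q_\phi$ with $Q\le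 P$, the generalized piece $P{\uparrow}Q_\phi$ is the equivalence class of $(P,Q_\phi)$, where $(P,Q_\phi)$ and $(P',Q'_{\phi'})$ are equivalent when $P=P'$ and $Q_\phi$, $Q'_{\phi'}$ are $P$-conjugate. Write $\overline N_P(Q)=N_P(Q)/Q$, which acts on $C_G(Q)$ by conjugation, and $\overline N_P(Q_\phi)=N_P(Q_\phi)/Q$, where $N_P(Q_\phi)$ is the stabilizer of $Q_\phi$ in $P$. With $\overline P=\overline N_P(Q)$, the absolute multiplicity of $P{\uparrow}Q_\phi$ is $$m(P{\uparrow}Q_\phi)=m\bigl(\mathbb F\overline P,\ \mathrm{Res}_{\overline P}\,V(\phi_{\rtimes\overline P})\bigr),$$ where $V(\phi_{\rtimes\overline P})$ is a simple $\mathbb F(C_G(Q)\rtimes\overline P)$-module and $\mathbb F\overline P$ is the regular module; $P{\uparrow}Q_\phi$ is called substantive when $\mathrm{Res}_{\overline P}\,V(\phi_{\rtimes\overline P})$ has a nonzero free direct summand. Neither notion depends on the choice of $Q_\phi$ in its $P$-conjugacy class. **Proposition 3.2.** Let $P{\uparrow}Q_\phi$ be a generalized piece of $\mathbb F G$ and let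 $\overline N_P(Q_\phi)\le S\le\overline N_P(Q)$. Then $$m(P{\uparrow}Q_\phi)=m\bigl(\mathbb F S,\ \mathrm{Res}^{C_G(Q)\rtimes S}_{S}\,V(\phi_{\rtimes S})\bigr).$$ In particular, $P{\uparrow}Q_\phi$ is substantive if and only if the restriction to $S$ of the simple $\mathbb F(C_G(Q)\rtimes S)$-module $V(\phi_{\rtimes S})$ has a nonzero free direct summand. -/

import Mathlib

noncomputable section

namespace GenPiece

open scoped Pointwise

universe u v w

/-! ### Brauer characters, direct summands and multiplicities -/

section Modules

variable (p : ℕ) {F : Type u} {L : Type v} [Field F] [Field L]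
  (ι : CommGroup.torsion Fˣ →* CommGroup.torsion Lˣ)

/-- The `p`-regular elements of a group. -/
abbrev PRegular (H : Type*) [Group H] : Type _ := {h : H // (orderOf h).Coprime p}

open Classical in
/-- The lift to `L` of an eigenvalue `a : F`, by means of `ι`. The eigenvalues of an element of
finite order are torsion units, so the value `0` given to other elements of `F` never matters. -/
def liftEigenvalue (a : F) : L :=
  if h : ∃ x : CommGroup.torsion Fˣ, ((x : Fˣ) : F) = a then ((ι h.choose : Lˣ) : L) else 0

/-- The Brauer character of a representation: at a `p`-regular element, the sum of the lifts
of the eigenvalues (roots of the characteristic polynomial, with multiplicity). -/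
def brauerChar {H : Type*} [Group H] {V : Type*} [AddCommGroup V] [Module F V]
    [FiniteDimensional F V] (ρ : Representation F H V) : PRegular p H → L :=
  fun h => ((ρ h.1).charpoly.roots.map (liftEigenvalue ι)).sum

/-- The irreducible `F H`-characters: the Brauer characters of the simple `F H`-modules. -/
def Irr (H : Type w) [Group H] : Type (max v w) :=
  {χ : PRegular p H → L // ∃ (n : ℕ) (ρ : Representation F H (Fin n → F)),
    ρ.IsIrreducible ∧ brauerChar p ι ρ = χ}

variable {p ι}

/-- The dimension of the chosen module `V(χ)`. -/
def Irr.dim {H : Type w} [Group H] (χ : Irr p ι H) : ℕ := χ.2.choose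

/-- `V(χ)`: a simple `F H`-module with Brauer character `χ`. -/
def Irr.V {H : Type w} [Group H] (χ : Irr p ι H) : Representation F H (Fin χ.dim → F) :=
  χ.2.choose_spec.choose

theorem Irr.V_irreducible {H : Type w} [Group H] (χ : Irr p ι H) : χ.V.IsIrreducible :=
  χ.2.choose_spec.choose_spec.1

theorem Irr.brauerChar_V {H : Type w} [Group H] (χ : Irr p ι H) :
    brauerChar p ι χ.V = χ.1 :=
  χ.2.choose_spec.choose_spec.2

/-- A group isomorphism `e : H' ≃* H` carries irreducible characters of `H` to those of `H'`. -/
def Irr.comap {H H' : Type w} [Group H] [Group H'] (e : H' ≃* H) (χ : Irr p ι H) :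
    Irr p ι H' :=
  ⟨fun h => χ.1 ⟨e h.1, by rw [MulEquiv.orderOf_eq]; exact h.2⟩, by
    refine ⟨χ.dim, χ.V.comp e.toMonoidHom, ?_, ?_⟩
    · have := χ.V_irreducible
      let f : Subrepresentation (χ.V.comp e.toMonoidHom) ≃o Subrepresentation χ.V :=
        { toFun := fun U => ⟨U.toSubmodule, fun h x hx => by
            simpa using U.apply_mem_toSubmodule (e.symm h) hx⟩
          invFun := fun U => ⟨U.toSubmodule, fun h x hx =>
            U.apply_mem_toSubmodule (e h) hx⟩
          left_inv := fun U => rfl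
          right_inv := fun U => rfl
          map_rel_iff' := Iff.rfl }
      exact f.isSimpleOrder
    · rw [← χ.brauerChar_V]
      rfl⟩

instance {H : Type w} [Group H] : Nonempty (Irr p ι H) := by
  refine ⟨⟨_, 1, (1 : Representation F H (Fin 1 → F)), ?_, rfl⟩⟩
  have h1 : Module.finrank F (Fin 1 → F) = 1 := by simp
  have := isSimpleModule_iff_finrank_eq_one.mpr h1
  rw [isSimpleModule_iff] at this
  let f : Subrepresentation (1 : Representation F H (Fin 1 → F)) ≃o Submodule F (Fin 1 → F) :=
    { toFun := fun U => U.toSubmodule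
      invFun := fun U => ⟨U, fun h x hx => hx⟩
      left_inv := fun U => rfl
      right_inv := fun U => rfl
      map_rel_iff' := Iff.rfl }
  exact f.isSimpleOrder

/-- `σ` is isomorphic to a direct summand of `ρ`. -/
def IsSummand {H : Type*} [Group H] {V W : Type*} [AddCommGroup V] [Module F V]
    [AddCommGroup W] [Module F W] (σ : Representation F H V) (ρ : Representation F H W) : Prop :=
  ∃ (i : σ.IntertwiningMap ρ) (r : ρ.IntertwiningMap σ), ∀ x, r (i x) = x

/-- The direct sum of `n` copies of `σ`. -/
abbrev copies {H : Type*} [Group H] {V : Type*} [AddCommGroup V] [Module F V] (n : ℕ)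
    (σ : Representation F H V) : Representation F H (DirectSum (Fin n) fun _ => V) :=
  Representation.directSum fun _ : Fin n => σ

/-- `m(σ, ρ)`: the multiplicity of an indecomposable `σ` as a direct summand of a
finite-dimensional `ρ`, that is, the largest `n` such that the direct sum of `n` copies of `σ` is
isomorphic to a direct summand of `ρ`. -/
def summandMultiplicity {H : Type*} [Group H] {V W : Type*} [AddCommGroup V] [Module F V]
    [AddCommGroup W] [Module F W] (σ : Representation F H V) (ρ : Representation F H W) : ℕ :=
  sSup {n : ℕ | IsSummand (copies n σ) ρ}

/-- `ρ` has a nonzero free direct summand. (For finite-dimensional `ρ` only free modules of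
finite rank need be considered.) -/
def HasNonzeroFreeSummand {H : Type*} [Group H] {W : Type*} [AddCommGroup W] [Module F W]
    (ρ : Representation F H W) : Prop :=
  ∃ n : ℕ, n ≠ 0 ∧ IsSummand (copies n (Representation.leftRegular F H)) ρ

end Modules

/-! ### The character `η_{⋊S}` of a semidirect product -/

section Semidirect

variable {p : ℕ} {F : Type u} {L : Type v} [Field F] [Field L]
  {ι : CommGroup.torsion Fˣ →* CommGroup.torsion Lˣ}

/-- The conjugate `ᵃV` of a representation `V` of `C` by an automorphism `a` of `C`: the element
`a c` acts on `ᵃV` as `c` acts on `V`. -/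
abbrev twist {C : Type*} [Group C] {V : Type*} [AddCommGroup V] [Module F V]
    (a : MulAut C) (ρ : Representation F C V) : Representation F C V :=
  ρ.comp (a⁻¹ : MulAut C).toMonoidHom

/-- The condition that the restriction of `V(ξ)` to `C` is a direct sum of mutually
non-isomorphic `S`-conjugates of `V(η)`. -/
def LiesOver {C S : Type w} [Group C] [Group S] (act : S →* MulAut C)
    (η : Irr p ι C) (ξ : Irr p ι (C ⋊[act] S)) : Prop :=
  ∃ (n : ℕ) (s : Fin n → S),
    (Pairwise fun i j =>
      IsEmpty ((twist (act (s i)) η.V).Equiv (twist (act (s j)) η.V))) ∧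
    Nonempty (Representation.Equiv
      (ξ.V.comp (SemidirectProduct.inl : C →* C ⋊[act] S))
      (Representation.directSum fun i : Fin n => twist (act (s i)) η.V))

/-- `η_{⋊S}`, for a finite `p`-group `S` acting on a finite group `C`: the irreducible character
`ξ` of `C ⋊ S` such that the restriction of `V(ξ)` to `C` is a direct sum of mutually
non-isomorphic `S`-conjugates of `V(η)`. (Over an algebraically closed field of characteristic
`p` there is exactly one.) -/
def semidirectChar {C S : Type w} [Group C] [Group S] (act : S →* MulAut C)
    (η : Irr p ι C) : Irr p ι (C ⋊[act] S) :=
  Classical.epsilon (LiesOver act η)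

/-- The restriction to `S` of a representation of `C ⋊ S`. -/
abbrev resS {C S : Type*} [Group C] [Group S] {act : S →* MulAut C} {W : Type*}
    [AddCommGroup W] [Module F W] (ρ : Representation F (C ⋊[act] S) W) : Representation F S W :=
  ρ.comp (SemidirectProduct.inr : S →* C ⋊[act] S)

end Semidirect

/-! ### Centralizers and normalizers -/

section Groups

variable {G : Type w} [Group G]

/-- `C_G(Q)`. -/
abbrev Cent (Q : Subgroup G) : Subgroup G := Subgroup.centralizer (Q : Set G)

/-- `N_P(Q)`. -/
abbrev NP (P Q : Subgroup G) : Subgroup G := Subgroup.normalizer (Q : Set G) ⊓ P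

instance (P Q : Subgroup G) : (Q.subgroupOf (NP P Q)).Normal :=
  Subgroup.normal_subgroupOf_of_le_normalizer inf_le_left

/-- `N_P(Q)/Q`, for `Q ≤ P`. -/
abbrev NBar (P Q : Subgroup G) : Type w := NP P Q ⧸ Q.subgroupOf (NP P Q)

theorem conj_mem_cent {Q : Subgroup G} {x c : G} (hx : x ∈ Subgroup.normalizer (Q : Set G))
    (hc : c ∈ Cent Q) : x * c * x⁻¹ ∈ Cent Q := by
  rw [Subgroup.mem_centralizer_iff] at hc ⊢
  intro q hq
  have h1 : x⁻¹ * q * x ∈ Q := (Subgroup.mem_normalizer_iff''.mp hx q).mp hq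
  have h2 := hc _ h1
  calc q * (x * c * x⁻¹) = x * ((x⁻¹ * q * x) * c) * x⁻¹ := by group
    _ = x * (c * (x⁻¹ * q * x)) * x⁻¹ := by rw [h2]
    _ = x * c * x⁻¹ * q := by group

/-- The conjugation action of `N_P(Q)` on `C_G(Q)`, where `x` sends `c` to `x c x⁻¹`. -/
def conjAct (P Q : Subgroup G) : NP P Q →* MulAut (Cent Q) where
  toFun x :=
    { toFun := fun c => ⟨x * c * (x : G)⁻¹, conj_mem_cent x.2.1 c.2⟩
      invFun := fun c => ⟨(x : G)⁻¹ * c * x, by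
        simpa using conj_mem_cent (inv_mem x.2.1) c.2⟩
      left_inv := fun c => by ext; simp [mul_assoc]
      right_inv := fun c => by ext; simp [mul_assoc]
      map_mul' := fun c d => by ext; simp [mul_assoc] }
  map_one' := by ext; simp
  map_mul' x y := by ext; simp [mul_assoc]

/-- The action of `N_P(Q)/Q` on `C_G(Q)` induced by conjugation. -/
def barAct (P Q : Subgroup G) : NBar P Q →* MulAut (Cent Q) :=
  QuotientGroup.lift _ (conjAct P Q) (by
    intro x hx
    ext c
    have hxQ : (x : G) ∈ (Q : Set G) := Subgroup.mem_subgroupOf.mp hx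
    have h := (Subgroup.mem_centralizer_iff.mp c.2) x hxQ
    simp [conjAct, h])

theorem mem_cent_conj {Q : Subgroup G} {g c : G} :
    c ∈ Cent (MulAut.conj g • Q) ↔ g⁻¹ * c * g ∈ Cent Q := by
  simp only [Subgroup.mem_centralizer_iff]
  constructor
  · intro h q hq
    have h1 : g * q * g⁻¹ ∈ ((MulAut.conj g • Q : Subgroup G) : Set G) :=
      Subgroup.smul_mem_pointwise_smul q (MulAut.conj g) Q hq
    have h2 := h _ h1
    calc q * (g⁻¹ * c * g) = g⁻¹ * ((g * q * g⁻¹) * c) * g := by group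
      _ = g⁻¹ * (c * (g * q * g⁻¹)) * g := by rw [h2]
      _ = g⁻¹ * c * g * q := by group
  · intro h q hq
    obtain ⟨r, hr, rfl⟩ := (Subgroup.mem_smul_pointwise_iff_exists _ _ _).mp hq
    have h2 := h r hr
    simp only [MulAut.smul_def, MulAut.conj_apply]
    calc (g * r * g⁻¹) * c = g * (r * (g⁻¹ * c * g)) * g⁻¹ := by group
      _ = g * (g⁻¹ * c * g * r) * g⁻¹ := by rw [h2]
      _ = c * (g * r * g⁻¹) := by group

/-- The isomorphism from `C_G(ᵍQ)` to `C_G(Q)` sending `c` to `g⁻¹ c g`. -/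
def centConj (g : G) (Q : Subgroup G) : Cent (MulAut.conj g • Q) ≃* Cent Q where
  toFun c := ⟨g⁻¹ * c * g, mem_cent_conj.mp c.2⟩
  invFun c := ⟨g * c * g⁻¹, mem_cent_conj.mpr (by simp [mul_assoc])⟩
  left_inv c := by ext; simp [mul_assoc]
  right_inv c := by ext; simp [mul_assoc]
  map_mul' c d := by ext; simp [mul_assoc]

end Groups

/-! ### Pieces and generalized pieces -/

section Pieces

variable (p : ℕ) {F : Type u} {L : Type v} [Field F] [Field L]
  (ι : CommGroup.torsion Fˣ →* CommGroup.torsion Lˣ) (G : Type w) [Group G]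

/-- A piece `Q_φ` of `F G`. -/
structure Piece where
  /-- the `p`-subgroup `Q` -/
  Q : Subgroup G
  isPGroup : IsPGroup p Q
  /-- the irreducible `F C_G(Q)`-character `φ` -/
  φ : Irr p ι (Cent Q)

variable {p ι G}

theorem Piece.ext' {A B : Piece p ι G} (hQ : A.Q = B.Q)
    (hφ : ∀ (c : G) (hA : c ∈ Cent A.Q) (hB : c ∈ Cent B.Q)
      (oA : (orderOf (⟨c, hA⟩ : Cent A.Q)).Coprime p)
      (oB : (orderOf (⟨c, hB⟩ : Cent B.Q)).Coprime p),
      A.φ.1 ⟨⟨c, hA⟩, oA⟩ = B.φ.1 ⟨⟨c, hB⟩, oB⟩) : A = B := by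
  obtain ⟨Q, hP, φ⟩ := A
  obtain ⟨Q', hP', φ'⟩ := B
  obtain rfl : Q = Q' := hQ
  have : φ = φ' := by
    apply Subtype.ext
    funext c
    exact hφ c.1.1 c.1.2 c.1.2 c.2 c.2
  rw [this]

/-- `G` permutes the pieces: `ᵍ(Q_φ)` is `(ᵍQ)_{ᵍφ}`, where `ᵍφ (c) = φ (g⁻¹ c g)`. -/
instance : SMul G (Piece p ι G) where
  smul g A :=
    { Q := MulAut.conj g • A.Q
      isPGroup := A.isPGroup.map (MulAut.conj g).toMonoidHom
      φ := A.φ.comap (centConj g A.Q) }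

theorem Piece.smul_Q (g : G) (A : Piece p ι G) : (g • A).Q = MulAut.conj g • A.Q := rfl

theorem Piece.smul_φ (g : G) (A : Piece p ι G) : (g • A).φ = A.φ.comap (centConj g A.Q) := rfl

/-- Values of a character at equal elements of `G` are equal. -/
theorem Piece.φ_congr (A : Piece p ι G) {c d : PRegular p (Cent A.Q)}
    (h : (c.1 : G) = d.1) : A.φ.1 c = A.φ.1 d := by
  have : c = d := Subtype.ext (Subtype.ext h)
  rw [this]

instance : MulAction G (Piece p ι G) where
  one_smul A := by
    refine Piece.ext' (by simp [Piece.smul_Q]) ?_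
    intro c hA hB oA oB
    exact A.φ_congr (by simp [centConj])
  mul_smul g h A := by
    refine Piece.ext' (by simp [Piece.smul_Q, mul_smul]) ?_
    intro c hA hB oA oB
    exact A.φ_congr (by simp [centConj, mul_assoc])

/-- `N_P(Q_φ)/Q`, as a subgroup of `N_P(Q)/Q`, where `N_P(Q_φ)` is the stabilizer of `Q_φ`
in `P`. -/
def NBarStab (P : Subgroup G) (A : Piece p ι G) : Subgroup (NBar P A.Q) :=
  ((MulAction.stabilizer G A ⊓ P).subgroupOf (NP P A.Q)).map (QuotientGroup.mk' _)

variable (p ι G)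

/-- The pairs `(P, Q_φ)` with `P` a `p`-subgroup of `G` and `Q_φ` a piece such that `Q ≤ P`. -/
structure PrePiece where
  P : Subgroup G
  isPGroup : IsPGroup p P
  piece : Piece p ι G
  le : piece.Q ≤ P

/-- `(P, Q_φ)` and `(P', Q'_φ')` are equivalent when `P = P'` and `Q_φ`, `Q'_φ'` are
`P`-conjugate. -/
instance PrePiece.setoid : Setoid (PrePiece p ι G) where
  r X Y := X.P = Y.P ∧ ∃ x ∈ X.P, x • X.piece = Y.piece
  iseqv :=
    { refl := fun X => ⟨rfl, 1, X.P.one_mem, one_smul _ _⟩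
      symm := by
        rintro X Y ⟨h, x, hx, e⟩
        exact ⟨h.symm, x⁻¹, h ▸ X.P.inv_mem hx, by rw [← e, inv_smul_smul]⟩
      trans := by
        rintro X Y Z ⟨h, x, hx, e⟩ ⟨h', y, hy, e'⟩
        exact ⟨h.trans h', y * x, X.P.mul_mem (h ▸ hy) hx, by rw [mul_smul, e, e']⟩ }

/-- A generalized piece of `F G`. -/
def GeneralizedPiece : Type _ := Quotient (PrePiece.setoid p ι G)

variable {p ι G}

/-- The generalized piece `P ↑ Q_φ`. -/
def up (P : Subgroup G) (hP : IsPGroup p P) (A : Piece p ι G) (hA : A.Q ≤ P) :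
    GeneralizedPiece p ι G :=
  Quotient.mk (PrePiece.setoid p ι G) ⟨P, hP, A, hA⟩

/-- The simple `F (C_G(Q) ⋊ P̄)`-module `V(φ_{⋊P̄})` restricted to `P̄ = N_P(Q)/Q`. -/
def PrePiece.barModule (X : PrePiece p ι G) :
    Representation F (NBar X.P X.piece.Q)
      (Fin (semidirectChar (barAct X.P X.piece.Q) X.piece.φ).dim → F) :=
  resS (semidirectChar (barAct X.P X.piece.Q) X.piece.φ).V

/-- The absolute multiplicity `m(P ↑ Q_φ)`: make a choice of `Q_φ` and take the multiplicity of
the regular module `F P̄` in the restriction of `V(φ_{⋊P̄})` to `P̄ = N_P(Q)/Q`. -/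
def GeneralizedPiece.m (X : GeneralizedPiece p ι G) : ℕ :=
  summandMultiplicity (Representation.leftRegular F (NBar X.out.P X.out.piece.Q))
    X.out.barModule

/-- `P ↑ Q_φ` is substantive when, for a choice of `Q_φ`, the restriction of `V(φ_{⋊P̄})` to
`P̄ = N_P(Q)/Q` has a nonzero free direct summand. -/
def GeneralizedPiece.Substantive (X : GeneralizedPiece p ι G) : Prop :=
  HasNonzeroFreeSummand X.out.barModule

end Pieces

end GenPiece

end

/-!
Write `C = C_G(Q)`, let `P̄ = N_P(Q)/Q` and let `T ≤ P̄` be the stabilizer of `φ`. Both multiplicities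
in the theorem equal the rank of `∑ t ∈ T, t` on one extension of `V(φ)` to `C ⋊ T`, an expression
in which `S` no longer occurs. This rests on four facts.

* Simple modules with the same Brauer character are isomorphic
  (`nonempty_equiv_of_brauerChar_eq`). The power sums of the lifted eigenvalues of a `p`-regular
  element are Brauer character values, so in characteristic `0` they determine the eigenvalues and
  hence the traces; since `tr(g ^ pⁿ) = tr(g) ^ pⁿ` in characteristic `p`, all traces agree; and the
  Jacobson density theorem separates the traces of non-isomorphic simple modules.
* For a finite `p`-group `S` in characteristic `p`, the multiplicity of the regular module in a
  finite-dimensional module is the rank of `∑ s ∈ S, s` (`summandMultiplicity_leftRegular`,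
  `hasNonzeroFreeSummand_iff`), since every nonzero submodule of a free module meets the socle, which
  is spanned by the multiples of `∑ s` in the summands.
* `V(φ)` extends to `C ⋊ T` (`exists_extension`): the obstruction is a `2`-cocycle of the `p`-group
  `T` with values in `Fˣ`, where taking `p`-th roots is possible and unique.
* For `T ≤ S ≤ P̄`, the module induced from `C ⋊ T` to `C ⋊ S` is simple
  (`isIrreducible_coind`), it restricts to `C` as a sum of pairwise non-isomorphic conjugates of
  `V(φ)` (`coindEquivDirectSum`), so that `φ_{⋊S}` exists (`exists_liesOver`), and every
  simple module of `C ⋊ S` with a nonzero `C`-map to `V(φ)` is isomorphic to it: the space of such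
  maps is acted on by the `p`-group `T`, which fixes a nonzero one, and Frobenius reciprocity applies
  (`nonempty_equiv_coind`). On the induced module `∑ s` has the same rank as `∑ t` on the extension
  (`normRank_coind`), because it sends `f` to the constant function with value `∑ s, f s`.

The absolute multiplicity is computed for some `P`-conjugate of the piece; conjugation transports all
the data (`normRank_barModule`).
-/

noncomputable section

namespace GenPiece

open scoped Pointwise MonoidAlgebra

universe u v w

/-! ### Brauer characters determine simple modules -/

section Eigenvalues

open Polynomial

variable {F V : Type*} [Field F] [AddCommGroup V] [Module F V] [FiniteDimensional F V]

theorem isOfFinOrder_of_mem_roots_charpoly {f : Module.End F V} (hf : IsOfFinOrder f) {a : F}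
    (ha : a ∈ f.charpoly.roots) : IsOfFinOrder a := by
  obtain ⟨n, hn, h⟩ := isOfFinOrder_iff_pow_eq_one.mp hf
  refine isOfFinOrder_iff_pow_eq_one.mpr ⟨n, hn, ?_⟩
  have hev : Module.End.HasEigenvalue f a :=
    (Module.End.hasEigenvalue_iff_isRoot_charpoly f a).mpr (Polynomial.isRoot_of_mem_roots ha)
  obtain ⟨v, hv⟩ := hev.exists_hasEigenvector
  have h2 := hv.pow_apply n
  rw [h, Module.End.one_apply] at h2
  have h3 : (a ^ n - 1) • v = 0 := by rw [sub_smul, ← h2, one_smul, sub_self]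
  exact sub_eq_zero.mp ((smul_eq_zero.mp h3).resolve_right hv.2)

variable [IsAlgClosed F]

/-- The determinant of `q(f)` is the product of `q` over the eigenvalues of `f`; since `q` splits, it
suffices to treat constants and linear polynomials. -/
theorem det_aeval_eq_prod_roots_charpoly (f : Module.End F V) (q : F[X]) :
    LinearMap.det (aeval f q) = (f.charpoly.roots.map fun a => q.eval a).prod := by
  have hprod := (IsAlgClosed.splits f.charpoly).eq_prod_roots_of_monic f.charpoly_monic
  have hcard : f.charpoly.roots.card = Module.finrank F V := by
    rw [← (IsAlgClosed.splits f.charpoly).natDegree_eq_card_roots, f.charpoly_natDegree]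
  have hq : q ∈ Submonoid.closure ({x | ∃ a, C a = x} ∪ {x | ∃ a, X + C a = x}) :=
    IsAlgClosed.splits q
  induction hq using Submonoid.closure_induction with
  | one => simp
  | mul x y _ _ hx hy => simp [Multiset.prod_map_mul, hx, hy]
  | mem x hx =>
    rcases hx with ⟨a, rfl⟩ | ⟨a, rfl⟩
    · simp [hcard, Module.algebraMap_end_eq_smul_id, LinearMap.det_smul]
    · have h1 : aeval f (X + C a) = (-1 : F) • ((algebraMap F (Module.End F V)) (-a) - f) := by
        ext v; simp [Module.algebraMap_end_eq_smul_id]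
      rw [h1, LinearMap.det_smul, ← LinearMap.eval_charpoly, ← hcard]
      conv_lhs =>
        enter [2]
        rw [hprod, Polynomial.eval_multiset_prod]
      rw [Multiset.map_map, ← Multiset.prod_replicate, ← Multiset.map_const',
        ← Multiset.prod_map_mul]
      congr 1
      refine Multiset.map_congr rfl fun b _ => ?_
      simp

/-- The eigenvalues of `f ^ k` are the `k`-th powers of those of `f`, with multiplicities. -/
theorem roots_charpoly_pow (f : Module.End F V) (k : ℕ) :
    (f ^ k).charpoly.roots = f.charpoly.roots.map (· ^ k) := by
  have h : (f ^ k).charpoly = ((f.charpoly.roots.map (· ^ k)).map fun a => X - C a).prod := by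
    refine Polynomial.funext fun y => ?_
    rw [LinearMap.eval_charpoly, Polynomial.eval_multiset_prod, Multiset.map_map, Multiset.map_map]
    have := det_aeval_eq_prod_roots_charpoly f (C y - X ^ k)
    simpa using this
  rw [h, roots_multiset_prod_X_sub_C]

theorem trace_eq_sum_roots (f : Module.End F V) :
    LinearMap.trace F V f = f.charpoly.roots.sum :=
  Module.End.trace_eq_sum_roots_charpoly_of_splits (IsAlgClosed.splits _)

theorem trace_pow_char_pow (p : ℕ) [Fact p.Prime] [CharP F p] (f : Module.End F V) (n : ℕ) :
    LinearMap.trace F V (f ^ p ^ n) = LinearMap.trace F V f ^ p ^ n := by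
  rw [trace_eq_sum_roots, trace_eq_sum_roots, roots_charpoly_pow]
  have := map_multiset_sum (iterateFrobenius F p n) f.charpoly.roots
  rw [iterateFrobenius_def] at this
  exact (this.trans (congrArg Multiset.sum
    (Multiset.map_congr rfl fun x _ => iterateFrobenius_def p n x))).symm

end Eigenvalues

/-- In characteristic `0` a finite multiset is determined by its power sums, because the functions
`k ↦ x ^ k` are linearly independent. -/
theorem multiset_eq_of_sum_pow_eq {L : Type*} [Field L] [CharZero L] {s t : Multiset L}
    (h : ∀ k : ℕ, (s.map (· ^ k)).sum = (t.map (· ^ k)).sum) : s = t := by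
  classical
  have key : ∀ (m : Multiset L) (u : Finset L) (k : ℕ), m.toFinset ⊆ u →
      (m.map (· ^ k)).sum = ∑ x ∈ u, (m.count x : L) * x ^ k := by
    intro m u k hu
    rw [Finset.sum_multiset_map_count]
    simp only [nsmul_eq_mul]
    refine Finset.sum_subset hu fun x _ hx => ?_
    rw [Multiset.count_eq_zero_of_notMem (by simpa using hx)]
    simp
  have hli := (linearIndependent_monoidHom (Multiplicative ℕ) L).comp (powersHom L)
    (powersHom L).injective
  rw [linearIndependent_iff'] at hli
  have h0 := hli (s.toFinset ∪ t.toFinset) (fun x => (s.count x : L) - t.count x) (by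
    funext k
    have := h k.toAdd
    rw [key s _ _ Finset.subset_union_left, key t _ _ Finset.subset_union_right,
      ← sub_eq_zero, ← Finset.sum_sub_distrib] at this
    simpa [sub_mul, Finset.sum_apply, powersHom_apply] using this)
  ext x
  by_cases hx : x ∈ s.toFinset ∪ t.toFinset
  · exact_mod_cast sub_eq_zero.mp (h0 x hx)
  · simp only [Finset.mem_union, Multiset.mem_toFinset, not_or] at hx
    rw [Multiset.count_eq_zero_of_notMem hx.1, Multiset.count_eq_zero_of_notMem hx.2]

section Brauer

variable {p : ℕ} {F : Type*} {L : Type*} [Field F] [Field L]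
  {ι : CommGroup.torsion Fˣ →* CommGroup.torsion Lˣ}

theorem liftEigenvalue_coe (x : CommGroup.torsion Fˣ) :
    liftEigenvalue ι ((x : Fˣ) : F) = ((ι x : Lˣ) : L) := by
  have h : ∃ y : CommGroup.torsion Fˣ, ((y : Fˣ) : F) = ((x : Fˣ) : F) := ⟨x, rfl⟩
  have : h.choose = x := Subtype.ext (Units.ext h.choose_spec)
  rw [liftEigenvalue, dif_pos h, this]

variable {H : Type*} [Group H] {V W : Type*} [AddCommGroup V] [Module F V] [FiniteDimensional F V]
  [AddCommGroup W] [Module F W] [FiniteDimensional F W]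

theorem charpoly_eq_of_equiv {ρ : Representation F H V} {σ : Representation F H W}
    (e : ρ.Equiv σ) (h : H) : (ρ h).charpoly = (σ h).charpoly := by
  rw [← Representation.Equiv.conj_apply_self h e, LinearEquiv.charpoly_conj]

theorem brauerChar_congr {ρ : Representation F H V} {σ : Representation F H W}
    (e : ρ.Equiv σ) : brauerChar p ι ρ = brauerChar p ι σ := by
  funext h
  simp only [brauerChar, charpoly_eq_of_equiv e]

theorem exists_torsion_roots [Finite H] (ρ : Representation F H V) (h : H) :
    ∃ T : Multiset (CommGroup.torsion Fˣ),
      (ρ h).charpoly.roots = T.map fun x : CommGroup.torsion Fˣ => ((x : Fˣ) : F) := by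
  have hf : IsOfFinOrder (ρ h) := MonoidHom.isOfFinOrder ρ (isOfFinOrder_of_finite h)
  have : ∀ m : Multiset F, (∀ a ∈ m, IsOfFinOrder a) →
      ∃ T : Multiset (CommGroup.torsion Fˣ), m = T.map fun x : CommGroup.torsion Fˣ => ((x : Fˣ) : F) := by
    intro m
    induction m using Multiset.induction_on with
    | empty => exact fun _ => ⟨0, rfl⟩
    | cons a m ih =>
      intro hm
      obtain ⟨T, hT⟩ := ih fun b hb => hm b (Multiset.mem_cons_of_mem hb)
      have ha := hm a (Multiset.mem_cons_self a m)
      obtain ⟨u, rfl⟩ := ha.isUnit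
      refine ⟨⟨u, ?_⟩ ::ₘ T, by simp [← hT]⟩
      exact (Units.isOfFinOrder_val).mp ha
  exact this _ fun a ha => isOfFinOrder_of_mem_roots_charpoly hf ha

variable [IsAlgClosed F]

theorem brauerChar_pow [Finite H] (ρ : Representation F H V) {h : H}
    (T : Multiset (CommGroup.torsion Fˣ))
    (hT : (ρ h).charpoly.roots = T.map fun x : CommGroup.torsion Fˣ => ((x : Fˣ) : F)) (k : ℕ)
    (hk : (orderOf (h ^ k)).Coprime p) :
    brauerChar p ι ρ ⟨h ^ k, hk⟩ = ((T.map fun x : CommGroup.torsion Fˣ => ((ι x : Lˣ) : L)).map (· ^ k)).sum := by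
  simp only [brauerChar, map_pow, roots_charpoly_pow, hT, Multiset.map_map, Function.comp_def]
  congr 1
  refine Multiset.map_congr rfl fun x _ => ?_
  have := liftEigenvalue_coe (ι := ι) (x ^ k)
  simpa using this

/-- The Brauer character determines the eigenvalues of the `p`-regular elements, since the power
sums of their lifts are values of the Brauer character at powers. -/
theorem roots_charpoly_eq_of_brauerChar_eq [CharZero L] (hι : Function.Injective ι) [Finite H]
    {ρ : Representation F H V} {σ : Representation F H W}
    (hχ : brauerChar p ι ρ = brauerChar p ι σ) {h : H} (hh : (orderOf h).Coprime p) :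
    (ρ h).charpoly.roots = (σ h).charpoly.roots := by
  obtain ⟨T, hT⟩ := exists_torsion_roots ρ h
  obtain ⟨T', hT'⟩ := exists_torsion_roots σ h
  have hinj : Function.Injective fun x : CommGroup.torsion Fˣ => ((ι x : Lˣ) : L) := by
    intro x y hxy
    exact hι (Subtype.ext (Units.ext hxy))
  have : (T.map fun x : CommGroup.torsion Fˣ => ((ι x : Lˣ) : L)) = T'.map fun x : CommGroup.torsion Fˣ => ((ι x : Lˣ) : L) := by
    refine multiset_eq_of_sum_pow_eq fun k => ?_
    have hk : (orderOf (h ^ k)).Coprime p := hh.coprime_dvd_left (orderOf_pow_dvd k)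
    rw [← brauerChar_pow ρ T hT k hk, ← brauerChar_pow σ T' hT' k hk, hχ]
  rw [hT, hT', Multiset.map_injective hinj this]

/-- Some power `g ^ pⁿ` is `p`-regular, and `tr (g ^ pⁿ) = (tr g) ^ pⁿ` determines `tr g`. -/
theorem trace_eq_of_brauerChar_eq [CharZero L] [Fact p.Prime] [CharP F p]
    (hι : Function.Injective ι) [Finite H]
    {ρ : Representation F H V} {σ : Representation F H W}
    (hχ : brauerChar p ι ρ = brauerChar p ι σ) (h : H) :
    LinearMap.trace F V (ρ h) = LinearMap.trace F W (σ h) := by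
  have hp : p.Prime := Fact.out
  obtain ⟨n, m, hm, hnm⟩ :=
    Nat.exists_eq_pow_mul_and_not_dvd (orderOf_pos h).ne' p hp.ne_one
  have hreg : (orderOf (h ^ p ^ n)).Coprime p := by
    rw [orderOf_pow_of_dvd (pow_ne_zero n hp.ne_zero) (hnm ▸ dvd_mul_right _ _), hnm,
      Nat.mul_div_cancel_left _ (pow_pos hp.pos n)]
    exact ((Nat.Prime.coprime_iff_not_dvd hp).mpr hm).symm
  have h1 : LinearMap.trace F V (ρ h) ^ p ^ n = LinearMap.trace F W (σ h) ^ p ^ n := by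
    rw [← trace_pow_char_pow, ← trace_pow_char_pow, ← map_pow, ← map_pow, trace_eq_sum_roots,
      trace_eq_sum_roots, roots_charpoly_eq_of_brauerChar_eq hι hχ hreg]
  exact iterateFrobenius_inj F p n (by simpa [iterateFrobenius_def] using h1)

end Brauer

section Density

variable {F : Type*} [Field F] [IsAlgClosed F] {H : Type*} [Group H]
  {V W : Type*} [AddCommGroup V] [Module F V] [FiniteDimensional F V]
  [AddCommGroup W] [Module F W] [FiniteDimensional F W]

/-- For non-isomorphic simple modules `V` and `W`, some element of the group algebra acts on `V` as
a given endomorphism and annihilates `W`. -/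
theorem exists_asAlgebraHom_eq_and_eq_zero {ρ : Representation F H V} {σ : Representation F H W}
    (hρ : ρ.IsIrreducible) (hσ : σ.IsIrreducible) (hne : IsEmpty (ρ.Equiv σ))
    (T : Module.End F V) : ∃ r : F[H], ρ.asAlgebraHom r = T ∧ σ.asAlgebraHom r = 0 := by
  classical
  have hne' : IsEmpty (σ.Equiv ρ) := ⟨fun e => hne.false e.symm⟩
  have h12 : ∀ f : ρ.asModule →ₗ[F[H]] σ.asModule, f = 0 := fun f => by
    rw [← map_zero (Representation.IntertwiningMap.equivLinearMapAsModule ρ σ),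
      ← (Representation.IntertwiningMap.equivLinearMapAsModule ρ σ).symm_apply_eq]
    exact Subsingleton.elim _ _
  have h21 : ∀ f : σ.asModule →ₗ[F[H]] ρ.asModule, f = 0 := fun f => by
    rw [← map_zero (Representation.IntertwiningMap.equivLinearMapAsModule σ ρ),
      ← (Representation.IntertwiningMap.equivLinearMapAsModule σ ρ).symm_apply_eq]
    exact Subsingleton.elim _ _
  -- By Schur's lemma every endomorphism of `V × W` acts on `V` as a scalar, so `(v, w) ↦ (T v, 0)`
  -- commutes with all of them, and density applies to it.
  let T' : ρ.asModule → ρ.asModule := fun v => ρ.asModuleEquiv.symm (T (ρ.asModuleEquiv v))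
  have hT'add : ∀ v w, T' (v + w) = T' v + T' w := fun v w => by simp [T']
  let M := ρ.asModule × σ.asModule
  have hcomm : ∀ (e : Module.End F[H] M) (x : M), T' (e x).1 = (e (T' x.1, 0)).1 ∧
      (e (T' x.1, 0)).2 = 0 := by
    intro e x
    have ha : (LinearMap.fst F[H] ρ.asModule σ.asModule ∘ₗ e) ∘ₗ
        LinearMap.inr F[H] ρ.asModule σ.asModule = 0 := h21 _
    have hb : (LinearMap.snd F[H] ρ.asModule σ.asModule ∘ₗ e) ∘ₗ
        LinearMap.inl F[H] ρ.asModule σ.asModule = 0 := h12 _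
    let e11 : Module.End F[H] ρ.asModule := (LinearMap.fst F[H] ρ.asModule σ.asModule ∘ₗ e) ∘ₗ
        LinearMap.inl F[H] ρ.asModule σ.asModule
    obtain ⟨c, hc⟩ :=
      (IsSimpleModule.algebraMap_end_bijective_of_isAlgClosed (A := F[H]) (V := ρ.asModule) F).2 e11
    have hc' : ∀ v, (e (v, 0)).1 = c • v := fun v => by
      have := congrArg (fun f => f v) hc
      simpa only [LinearMap.coe_comp, Function.comp_apply, LinearMap.inl_apply, e11] using! this.symm
    have h1 : (e x).1 = c • x.1 := by
      have hx : e x = e (x.1, 0) + e (0, x.2) := by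
        rw [← map_add, Prod.mk_add_mk, add_zero, zero_add]
      have h0 : (e (0, x.2)).1 = 0 := congrArg (fun f => f x.2) ha
      rw [hx, Prod.fst_add, h0, add_zero, hc']
    refine ⟨?_, congrArg (fun f => f (T' x.1)) hb⟩
    rw [h1, hc']
    simp [T']
  let f : Module.End (Module.End F[H] M) M :=
    { toFun := fun x => (T' x.1, 0)
      map_add' := fun x y => Prod.ext (hT'add _ _) (add_zero _).symm
      map_smul' := fun e x => by
        simp only [RingHom.id_apply, Module.End.smul_def]
        exact Prod.ext (hcomm e x).1 (hcomm e x).2.symm }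
  have hss : IsSemisimpleModule F[H] M := by
    have h1 := IsSemisimpleModule.range (LinearMap.inl F[H] ρ.asModule σ.asModule)
    have h2 := IsSemisimpleModule.range (LinearMap.inr F[H] ρ.asModule σ.asModule)
    have h3 := IsSemisimpleModule.sup h1 h2
    rw [LinearMap.sup_range_inl_inr] at h3
    exact IsSemisimpleModule.congr Submodule.topEquiv.symm
  let bV := Module.finBasis F V
  let bW := Module.finBasis F W
  obtain ⟨r, hr⟩ := jacobson_density f
    ((Finset.univ.image fun i => ((ρ.asModuleEquiv.symm (bV i), 0) : M)) ∪
      Finset.univ.image fun i => ((0, σ.asModuleEquiv.symm (bW i)) : M))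
  refine ⟨r, bV.ext fun i => ?_, bW.ext fun i => ?_⟩
  · have h1 := hr (ρ.asModuleEquiv.symm (bV i), 0) (by simp)
    have h2 : T' (ρ.asModuleEquiv.symm (bV i)) = r • ρ.asModuleEquiv.symm (bV i) :=
      congrArg Prod.fst h1
    have h3 := congrArg ρ.asModuleEquiv h2
    rw [Representation.asModuleEquiv_map_smul] at h3
    simpa [T'] using h3.symm
  · have h1 := hr (0, σ.asModuleEquiv.symm (bW i)) (by simp)
    have h2 : 0 = r • σ.asModuleEquiv.symm (bW i) := congrArg Prod.snd h1
    have h3 := congrArg σ.asModuleEquiv h2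
    rw [Representation.asModuleEquiv_map_smul] at h3
    simpa using h3.symm

theorem nonempty_equiv_of_trace_eq {ρ : Representation F H V} {σ : Representation F H W}
    (hρ : ρ.IsIrreducible) (hσ : σ.IsIrreducible)
    (h : ∀ g, LinearMap.trace F V (ρ g) = LinearMap.trace F W (σ g)) :
    Nonempty (ρ.Equiv σ) := by
  by_contra hne
  rw [not_nonempty_iff] at hne
  have hV : Nontrivial V := by
    have : Nontrivial ρ.asModule := IsSimpleModule.nontrivial F[H] ρ.asModule
    exact this
  obtain ⟨v, hv⟩ := exists_ne (0 : V)
  obtain ⟨φ, hφ⟩ := Module.Projective.exists_dual_ne_zero F hv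
  -- The functional `φ` followed by multiplication by `v` has trace `φ v ≠ 0`.
  obtain ⟨r, hr1, hr2⟩ := exists_asAlgebraHom_eq_and_eq_zero hρ hσ hne (φ.smulRight v)
  have htr : ∀ r : F[H], LinearMap.trace F V (ρ.asAlgebraHom r) =
      LinearMap.trace F W (σ.asAlgebraHom r) := by
    intro r
    induction r using MonoidAlgebra.induction_linear with
    | zero => simp
    | add x y hx hy => simp [hx, hy]
    | single g a => simp [h g]
  have := htr r
  rw [hr1, hr2, LinearMap.trace_smulRight, map_zero] at this
  exact hφ this

/-- Simple modules with the same Brauer character are isomorphic. -/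
theorem nonempty_equiv_of_brauerChar_eq {p : ℕ} [Fact p.Prime] [CharP F p] {L : Type*} [Field L]
    [CharZero L] {ι : CommGroup.torsion Fˣ →* CommGroup.torsion Lˣ} (hι : Function.Injective ι)
    [Finite H] {ρ : Representation F H V} {σ : Representation F H W}
    (hρ : ρ.IsIrreducible) (hσ : σ.IsIrreducible) (hχ : brauerChar p ι ρ = brauerChar p ι σ) :
    Nonempty (ρ.Equiv σ) :=
  nonempty_equiv_of_trace_eq hρ hσ (trace_eq_of_brauerChar_eq hι hχ)

end Density

/-! ### Free summands of modules for `p`-groups -/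

section FixedVectors

variable {p : ℕ} [Fact p.Prime] {F : Type*} [Field F] [CharP F p] {S : Type*} [Group S] [Finite S]
  {M : Type*} [AddCommGroup M] [Module F M]

/-- A finite `p`-group acting on a nonzero submodule in characteristic `p` has a nonzero fixed
vector there: count fixed points in the finite `𝔽_p`-span of an orbit. -/
theorem exists_ne_zero_fixed (hS : IsPGroup p S) (σ : Representation F S M)
    (U : Submodule F M) (hU : ∀ s, ∀ u ∈ U, σ s u ∈ U) (hne : U ≠ ⊥) :
    ∃ u ∈ U, u ≠ 0 ∧ ∀ s, σ s u = u := by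
  classical
  obtain ⟨v, hvU, hv⟩ := U.exists_mem_ne_zero_of_ne_bot hne
  let _ : Algebra (ZMod p) F := ZMod.algebra F p
  let _ : Module (ZMod p) M := Module.compHom M (algebraMap (ZMod p) F)
  have : IsScalarTower (ZMod p) F M := ⟨fun a b m => by
    rw [Algebra.smul_def, mul_smul]; rfl⟩
  let D : Submodule (ZMod p) M := Submodule.span (ZMod p) (Set.range fun s => σ s v)
  have hDfin : Module.Finite (ZMod p) D := Module.Finite.span_of_finite _ (Set.finite_range _)
  have hfin : Finite D := Module.finite_of_finite (ZMod p)
  have hDU : D ≤ U.restrictScalars (ZMod p) :=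
    Submodule.span_le.mpr (by rintro _ ⟨s, rfl⟩; exact hU s v hvU)
  have hD : ∀ s, ∀ u ∈ D, σ s u ∈ D := by
    intro s u hu
    induction hu using Submodule.span_induction with
    | mem x hx =>
      obtain ⟨t, rfl⟩ := hx
      refine Submodule.subset_span ⟨s * t, ?_⟩
      simp
    | zero => simp
    | add x y _ _ hx hy => rw [map_add]; exact D.add_mem hx hy
    | smul a x _ hx =>
      have : σ s (a • x) = a • σ s x := by
        rw [← algebraMap_smul F a x, map_smul, algebraMap_smul]
      rw [this]; exact D.smul_mem a hx
  let _ : MulAction S D :=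
    { smul := fun s u => ⟨σ s u, hD s u u.2⟩
      one_smul := fun u => Subtype.ext (by change σ 1 (u : M) = u; simp)
      mul_smul := fun s t u => Subtype.ext (by
        change σ (s * t) (u : M) = σ s (σ t u); simp) }
  have hsmul : ∀ (s : S) (u : D), ((s • u : D) : M) = σ s u := fun _ _ => rfl
  have hvD : v ∈ D := Submodule.subset_span ⟨1, by simp⟩
  have hcard : p ∣ Nat.card D := by
    have hnt : Nontrivial D := ⟨⟨⟨v, hvD⟩, 0, fun h => hv (congrArg Subtype.val h)⟩⟩
    have : Fintype D := Fintype.ofFinite D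
    rw [Nat.card_eq_fintype_card, Module.card_eq_pow_finrank (K := ZMod p), ZMod.card]
    exact dvd_pow_self p (Module.finrank_pos).ne'
  obtain ⟨u, hu, hne0⟩ := hS.exists_fixed_point_of_prime_dvd_card_of_fixed_point D hcard
    (a := (0 : D)) (fun s => Subtype.ext (by rw [hsmul]; simp))
  refine ⟨u, hDU u.2, fun h => hne0 (Subtype.ext h.symm), fun s => ?_⟩
  rw [← hsmul, hu s]

end FixedVectors

section FreeModules

variable {F : Type*} [Field F] {S : Type*} [Group S] {M : Type*} [AddCommGroup M] [Module F M]

theorem copies_apply {n : ℕ} (σ : Representation F S M) (s : S)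
    (x : DirectSum (Fin n) fun _ => M) (i : Fin n) : copies n σ s x i = σ s (x i) := by
  simp [copies]

/-- The map from the free module of rank `n` sending the `k`-th generator to `m k`. -/
def fromFree {n : ℕ} (σ : Representation F S M) (m : Fin n → M) :
    (copies n (Representation.leftRegular F S)).IntertwiningMap σ where
  toLinearMap := DirectSum.toModule F (Fin n) M fun k =>
    (LinearMap.applyₗ (m k)) ∘ₗ σ.asAlgebraHom.toLinearMap
  isIntertwining' s := by
    ext k t
    simp [copies]

theorem fromFree_of {n : ℕ} (σ : Representation F S M) (m : Fin n → M) (k : Fin n) (s : S) (a : F) :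
    fromFree σ m (DirectSum.of (fun _ : Fin n => F[S]) k (MonoidAlgebra.single s a)) =
      a • σ s (m k) := by
  have h : fromFree σ m (DirectSum.of (fun _ : Fin n => F[S]) k (MonoidAlgebra.single s a)) =
      σ.asAlgebraHom (MonoidAlgebra.single s a) (m k) :=
    DirectSum.toModule_lof (φ := fun k => (LinearMap.applyₗ (m k)) ∘ₗ σ.asAlgebraHom.toLinearMap)
      F k (MonoidAlgebra.single s a)
  rw [h, Representation.asAlgebraHom_single, LinearMap.smul_apply]

end FreeModules

section NormRank

variable {F : Type*} [Field F] {S : Type*} [Group S] [Finite S]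
  {M : Type*} [AddCommGroup M] [Module F M]

/-- The norm map: the action of the sum `∑ s` of all elements of the finite group `S`. -/
def normMap (σ : Representation F S M) : M →ₗ[F] M :=
  letI := Fintype.ofFinite S
  ∑ s, σ s

theorem normMap_apply [Fintype S] (σ : Representation F S M) (x : M) :
    normMap σ x = ∑ s, σ s x := by
  rw [normMap, LinearMap.sum_apply]
  exact Finset.sum_congr (Finset.ext fun _ => by simp) fun _ _ => rfl

theorem apply_normMap (σ : Representation F S M) (s : S) (x : M) :
    σ s (normMap σ x) = normMap σ x := by
  have := Fintype.ofFinite S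
  rw [normMap_apply, map_sum]
  exact Fintype.sum_bijective (s * ·) (Group.mulLeft_bijective s) _ _ fun t => by simp

theorem map_normMap {N : Type*} [AddCommGroup N] [Module F N] {σ : Representation F S M}
    {τ : Representation F S N} (f : σ.IntertwiningMap τ) (x : M) :
    f (normMap σ x) = normMap τ (f x) := by
  have := Fintype.ofFinite S
  rw [normMap_apply, normMap_apply, map_sum]
  exact Finset.sum_congr rfl fun s _ => f.isIntertwining σ τ s x

/-- The rank of the norm map of `S`. -/
def normRank (σ : Representation F S M) : ℕ :=
  Module.finrank F (LinearMap.range (normMap σ))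

/-- The element `∑ s` of the regular module. -/
def normElement (F S : Type*) [Field F] [Group S] [Finite S] : F[S] :=
  normMap (Representation.leftRegular F S) (MonoidAlgebra.single 1 1)

theorem normElement_coeff (s : S) : (normElement F S).coeff s = 1 := by
  classical
  have := Fintype.ofFinite S
  rw [normElement, normMap_apply]
  simp [Finsupp.single_apply]

/-- The fixed vectors of the regular module are the multiples of `∑ s`. -/
theorem leftRegular_fixed_eq_smul {x : F[S]} (hx : ∀ s, Representation.leftRegular F S s x = x) :
    x = x.coeff 1 • normElement F S := by
  ext s
  have h1 : (Representation.leftRegular F S s⁻¹ x).coeff 1 = x.coeff s := by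
    have h2 := Finsupp.mapDomain_apply (mul_right_injective s⁻¹) x.coeff s
    rw [inv_mul_cancel] at h2
    exact h2
  rw [hx] at h1
  simp [normElement_coeff, h1]

theorem normMap_copies_of {n : ℕ} (σ : Representation F S M) (i : Fin n) (x : M) :
    normMap (copies n σ) (DirectSum.of (fun _ : Fin n => M) i x) =
      DirectSum.of (fun _ : Fin n => M) i (normMap σ x) := by
  have := Fintype.ofFinite S
  rw [normMap_apply, normMap_apply, map_sum]
  refine Finset.sum_congr rfl fun s _ => ?_
  simp [copies]

/-- The `i`-th copy of the norm element in a free module of rank `n`. -/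
def normBasis (F S : Type*) [Field F] [Group S] [Finite S] {n : ℕ} (i : Fin n) :
    DirectSum (Fin n) fun _ => F[S] :=
  DirectSum.of (fun _ : Fin n => F[S]) i (normElement F S)

theorem sum_smul_normBasis_apply {n : ℕ} (c : Fin n → F) (i : Fin n) :
    (∑ k, c k • (normBasis F S k : DirectSum (Fin n) fun _ => F[S])) i =
      c i • normElement F S := by
  classical
  rw [DFinsupp.finsetSum_apply, Finset.sum_eq_single i]
  · rw [DirectSum.smul_apply, normBasis, DirectSum.of_eq_same]
  · intro k _ hk
    rw [DirectSum.smul_apply, normBasis, DirectSum.of_eq_of_ne _ _ _ hk.symm, smul_zero]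
  · simp

theorem linearIndependent_normBasis (n : ℕ) :
    LinearIndependent F (normBasis F S : Fin n → DirectSum (Fin n) fun _ => F[S]) := by
  classical
  rw [Fintype.linearIndependent_iff]
  intro g hg i
  have := congrArg (fun x : DirectSum (Fin n) fun _ => F[S] => (x i).coeff 1) hg
  simp only [sum_smul_normBasis_apply] at this
  simpa [normElement_coeff] using this

theorem le_normRank_of_isSummand [FiniteDimensional F M] {n : ℕ} {σ : Representation F S M}
    (h : IsSummand (copies n (Representation.leftRegular F S)) σ) : n ≤ normRank σ := by
  obtain ⟨i, r, hir⟩ := h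
  have hi : Function.Injective i.toLinearMap := Function.LeftInverse.injective hir
  have hli := (linearIndependent_normBasis (F := F) (S := S) n).map' i.toLinearMap
    (LinearMap.ker_eq_bot.mpr hi)
  have hmem : ∀ k, i.toLinearMap (normBasis F S k) ∈ LinearMap.range (normMap σ) := by
    intro k
    rw [normBasis, normElement, ← normMap_copies_of]
    exact ⟨_, (map_normMap i _).symm⟩
  have hli' : LinearIndependent F (fun k => (⟨_, hmem k⟩ : LinearMap.range (normMap σ))) :=
    LinearIndependent.of_comp (LinearMap.range (normMap σ)).subtype hli
  simpa [normRank] using hli'.fintype_card_le_finrank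

theorem fromFree_normBasis {n : ℕ} (σ : Representation F S M) (m : Fin n → M) (k : Fin n) :
    fromFree σ m (normBasis F S k) = normMap σ (m k) := by
  rw [normBasis, normElement, ← normMap_copies_of, map_normMap, fromFree_of]
  simp

/-- The map to the free module of rank `n` whose `k`-th coordinate is
`x ↦ ∑ s, l k (s⁻¹ x) • s`. -/
def toFree {n : ℕ} (σ : Representation F S M) (l : Fin n → M →ₗ[F] F) :
    σ.IntertwiningMap (copies n (Representation.leftRegular F S)) where
  toLinearMap :=
    letI := Fintype.ofFinite S
    ∑ k : Fin n, DirectSum.lof F (Fin n) (fun _ => F[S]) k ∘ₗ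
      ∑ s : S, MonoidAlgebra.lsingle s ∘ₗ l k ∘ₗ σ s⁻¹
  isIntertwining' t := by
    let _ := Fintype.ofFinite S
    refine LinearMap.ext fun x => ?_
    simp only [LinearMap.comp_apply, LinearMap.sum_apply, map_sum]
    refine Finset.sum_congr rfl fun k _ => ?_
    refine Fintype.sum_bijective (t⁻¹ * ·) (Group.mulLeft_bijective t⁻¹) _ _ fun s => ?_
    simp [copies]

theorem toFree_normMap {n : ℕ} (σ : Representation F S M) (l : Fin n → M →ₗ[F] F) (x : M) :
    toFree σ l (normMap σ x) = ∑ k, l k (normMap σ x) • normBasis F S k := by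
  have := Fintype.ofFinite S
  have h : toFree σ l (normMap σ x) = ∑ k : Fin n, DirectSum.lof F (Fin n) (fun _ => F[S]) k
      (∑ s : S, MonoidAlgebra.single s (l k (σ s⁻¹ (normMap σ x)))) := by
    rw [← Representation.IntertwiningMap.toLinearMap_apply, toFree]
    simp only [LinearMap.comp_apply, LinearMap.sum_apply]
    refine Finset.sum_congr rfl fun k _ => congrArg (DirectSum.lof F (Fin n) (fun _ => F[S]) k) ?_
    exact Finset.sum_congr (Finset.ext fun _ => by simp) fun _ _ => rfl
  rw [h]
  refine Finset.sum_congr rfl fun k _ => ?_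
  have h2 : normBasis F S k = DirectSum.lof F (Fin n) (fun _ => F[S]) k (normElement F S) := rfl
  rw [h2, ← map_smul]
  congr 1
  ext s
  simp [apply_normMap, normElement_coeff]

variable {p : ℕ} [Fact p.Prime] [CharP F p]

/-- Endomorphisms of a free module over a `p`-group algebra in characteristic `p` that fix the
socle are bijective. -/
theorem injective_of_fixes_normBasis (hS : IsPGroup p S) {n : ℕ}
    (f : (copies n (Representation.leftRegular F S)).IntertwiningMap
      (copies n (Representation.leftRegular F S)))
    (hf : ∀ k, f (normBasis F S k) = normBasis F S k) : Function.Injective f := by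
  classical
  have hker : LinearMap.ker f.toLinearMap = ⊥ := by
    by_contra hne
    obtain ⟨u, hu, hu0, hfix⟩ := exists_ne_zero_fixed hS
      (copies n (Representation.leftRegular F S)) (LinearMap.ker f.toLinearMap)
      (fun s u hu => by
        have hu' : f u = 0 := hu
        change f (copies n (Representation.leftRegular F S) s u) = 0
        rw [f.isIntertwining _ _, hu', map_zero]) hne
    refine hu0 ?_
    have hsum : u = ∑ k, (u k).coeff 1 • normBasis F S k := by
      refine DFinsupp.ext fun i => ?_
      have hfi : ∀ s, Representation.leftRegular F S s (u i) = u i := fun s => by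
        rw [← copies_apply, hfix]
      rw [sum_smul_normBasis_apply]
      exact leftRegular_fixed_eq_smul hfi
    have : f u = u := by
      conv_lhs => rw [hsum]
      rw [map_sum]
      simp only [map_smul, hf]
      exact hsum.symm
    rw [← this]
    exact hu
  exact LinearMap.ker_eq_bot.mp hker

/-- Vectors `m k` with linearly independent images under the norm map generate a free direct
summand. -/
theorem isSummand_copies_leftRegular (hS : IsPGroup p S) [FiniteDimensional F M]
    (σ : Representation F S M) {n : ℕ} (hn : n ≤ normRank σ) :
    IsSummand (copies n (Representation.leftRegular F S)) σ := by
  classical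
  have := Fintype.ofFinite S
  obtain ⟨b, hb⟩ : ∃ b : Fin n → LinearMap.range (normMap σ), LinearIndependent F b := by
    refine ⟨fun k => Module.finBasis F (LinearMap.range (normMap σ)) (Fin.castLE hn k), ?_⟩
    exact (Module.finBasis F (LinearMap.range (normMap σ))).linearIndependent.comp _
      (Fin.castLE_injective hn)
  choose m hm using fun k => (b k).2
  have hli : LinearIndependent F fun k => normMap σ (m k) := by
    simp only [hm]
    exact hb.map' (LinearMap.range (normMap σ)).subtype (Submodule.ker_subtype _)
  -- The coordinates of `g` are functionals dual to the vectors `normMap σ (m k)`.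
  obtain ⟨g, hg⟩ := LinearMap.exists_leftInverse_of_injective
    (Fintype.linearCombination F fun k => normMap σ (m k))
    (LinearMap.ker_eq_bot.mpr (hli.fintypeLinearCombination_injective))
  have hgk : ∀ k, g (normMap σ (m k)) = Pi.single k 1 := fun k => by
    have := congrArg (fun f => f (Pi.single k 1)) hg
    simpa [Fintype.linearCombination_apply_single] using this
  let i := fromFree σ m
  let r := toFree σ fun k => LinearMap.proj k ∘ₗ g
  have hri : ∀ k, (r.comp i) (normBasis F S k) = normBasis F S k := fun k => by
    simp only [Representation.IntertwiningMap.comp_apply, i, r, fromFree_normBasis,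
      toFree_normMap, LinearMap.comp_apply, hgk]
    simp [Pi.single_apply]
  -- `r ∘ i` fixes the socle, so it is invertible, and `(r ∘ i)⁻¹ ∘ r` splits `i`.
  have hinj := injective_of_fixes_normBasis hS (r.comp i) hri
  have hbij : Function.Bijective (r.comp i) :=
    ⟨hinj, (LinearMap.injective_iff_surjective (f := (r.comp i).toLinearMap)).mp hinj⟩
  let e := Representation.IntertwiningMap.ofBijective (r.comp i) hbij
  exact ⟨i, e.symm.toIntertwiningMap.comp r, fun x => e.symm_apply_apply x⟩

theorem isSummand_copies_leftRegular_iff (hS : IsPGroup p S) [FiniteDimensional F M]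
    (σ : Representation F S M) (n : ℕ) :
    IsSummand (copies n (Representation.leftRegular F S)) σ ↔ n ≤ normRank σ :=
  ⟨le_normRank_of_isSummand, isSummand_copies_leftRegular hS σ⟩

/-- For a `p`-group in characteristic `p`, the multiplicity of the regular module is the rank of
the sum of the group elements. -/
theorem summandMultiplicity_leftRegular (hS : IsPGroup p S) [FiniteDimensional F M]
    (σ : Representation F S M) :
    summandMultiplicity (Representation.leftRegular F S) σ = normRank σ := by
  simp only [summandMultiplicity, isSummand_copies_leftRegular_iff hS]
  exact csSup_Iic

theorem hasNonzeroFreeSummand_iff (hS : IsPGroup p S) [FiniteDimensional F M]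
    (σ : Representation F S M) : HasNonzeroFreeSummand σ ↔ normRank σ ≠ 0 := by
  simp only [HasNonzeroFreeSummand, isSummand_copies_leftRegular_iff hS]
  exact ⟨fun ⟨n, h0, h⟩ => by omega, fun h => ⟨_, h, le_rfl⟩⟩

end NormRank

/-! ### Extending an invariant simple module to a `p`-group of operators -/

section Extension

variable {F : Type*} [Field F] [IsAlgClosed F] {C : Type*} [Group C]
  {V : Type*} [AddCommGroup V] [Module F V] [FiniteDimensional F V]

theorem nontrivial_of_isIrreducible {F C V : Type*} [Field F] [Monoid C] [AddCommGroup V]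
    [Module F V] {ρ : Representation F C V} (hρ : ρ.IsIrreducible) : Nontrivial V := by
  have : Nontrivial ρ.asModule := IsSimpleModule.nontrivial F[C] ρ.asModule
  exact this

/-- Schur's lemma for two automorphisms that intertwine `ρ` with the same twist. -/
theorem exists_smul_eq_of_semilinear {ρ : Representation F C V} (hρ : ρ.IsIrreducible)
    (a : C → C) (f g : V ≃ₗ[F] V) (hf : ∀ c v, f (ρ c v) = ρ (a c) (f v))
    (hg : ∀ c v, g (ρ c v) = ρ (a c) (g v)) : ∃ x : F, ∀ v, f v = x • g v := by
  let h : ρ.IntertwiningMap ρ :=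
    { toLinearMap := (f.trans g.symm).toLinearMap
      isIntertwining' := fun c => LinearMap.ext fun v => g.injective (by simp [hf, hg]) }
  obtain ⟨x, hx⟩ :=
    (Representation.IsIrreducible.algebraMap_intertwiningMap_bijective_of_isAlgClosed (ρ := ρ)).2 h
  refine ⟨x, fun v => ?_⟩
  have h1 : g.symm (f v) = x • v := (congrArg (fun e => e v) hx).symm
  rw [← map_smul, ← h1, g.apply_symm_apply]

/-- A simple module that is invariant under a finite `p`-group `T` of operators, over an
algebraically closed field of characteristic `p`, extends to the semidirect product. The
obstruction `α` has trivial `|T|`-th power, by multiplying the cocycle identity over `T`, and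
`|T|`-th roots exist and are unique. -/
theorem exists_extension {p : ℕ} [Fact p.Prime] [CharP F p] {T : Type*} [Group T] [Finite T]
    (hT : IsPGroup p T) (act : T →* MulAut C) {ρ : Representation F C V} (hρ : ρ.IsIrreducible)
    (hinv : ∀ t, Nonempty ((twist (act t) ρ).Equiv ρ)) :
    ∃ τ : Representation F T V, ∀ t c v, τ t (ρ c v) = ρ (act t c) (τ t v) := by
  classical
  have := Fintype.ofFinite T
  have hV := nontrivial_of_isIrreducible hρ
  obtain ⟨v₀, hv₀⟩ := exists_ne (0 : V)
  let e := fun t => (hinv t).some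
  let M : T → V ≃ₗ[F] V := fun t => (e t).toLinearEquiv
  have hM : ∀ t c v, M t (ρ c v) = ρ (act t c) (M t v) := fun t c v => by
    have := (e t).toIntertwiningMap.isIntertwining _ _ (act t c) v
    simpa [twist] using! this
  have hα : ∀ s t, ∃ x : F, ∀ v, M s (M t v) = x • M (s * t) v := fun s t =>
    exists_smul_eq_of_semilinear hρ (fun c => act (s * t) c) ((M t).trans (M s)) (M (s * t))
      (fun c v => by simp [hM]) (fun c v => by simp [hM])
  choose α hα using hα
  have hα0 : ∀ s t, α s t ≠ 0 := fun s t h => by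
    have := hα s t v₀
    rw [h, zero_smul] at this
    simp [hv₀] at this
  have hcoc : ∀ r s t, α s t * α r (s * t) = α r s * α (r * s) t := fun r s t => by
    have h1 : M r (M s (M t v₀)) = (α s t * α r (s * t)) • M (r * s * t) v₀ := by
      rw [hα s t, map_smul, hα r, smul_smul, mul_assoc]
    have h2 : M r (M s (M t v₀)) = (α r s * α (r * s) t) • M (r * s * t) v₀ := by
      rw [hα r s, hα, smul_smul]
    have h3 : M (r * s * t) v₀ ≠ 0 := by simpa using hv₀
    exact smul_left_injective F h3 (h1.symm.trans h2)
  obtain ⟨n, hn⟩ := IsPGroup.iff_card.mp hT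
  rw [Nat.card_eq_fintype_card] at hn
  -- With `β s = ∏ t, α s t`, the cocycle identity says that `α ^ |T|` is the coboundary of `β`.
  have hβ : ∀ r s, (∏ t, α s t) * ∏ t, α r t = α r s ^ p ^ n * ∏ t, α (r * s) t := fun r s => by
    rw [← Fintype.prod_bijective (s * ·) (Group.mulLeft_bijective s) (fun t => α r (s * t)) _
      fun t => rfl, ← Finset.prod_mul_distrib, ← hn, ← Finset.card_univ, ← Finset.prod_const,
      ← Finset.prod_mul_distrib]
    exact Finset.prod_congr rfl fun t _ => hcoc r s t
  have hγ : ∀ s, ∃ g : F, g ^ p ^ n = ∏ t, α s t := fun s =>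
    IsAlgClosed.exists_pow_nat_eq _ (pow_pos (Fact.out : p.Prime).pos n)
  choose γ hγ using hγ
  have hγ0 : ∀ s, γ s ≠ 0 := fun s h => by
    have := hγ s
    rw [h, zero_pow (pow_ne_zero n (Fact.out : p.Prime).ne_zero)] at this
    exact Finset.prod_ne_zero_iff.mpr (fun t _ => hα0 s t) this.symm
  have hγα : ∀ r s, γ r * γ s = α r s * γ (r * s) := fun r s => by
    refine iterateFrobenius_inj F p n ?_
    simp only [iterateFrobenius_def, mul_pow, hγ]
    rw [← hβ, mul_comm]
  let τ : T → V →ₗ[F] V := fun t => (γ t)⁻¹ • (M t).toLinearMap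
  have hmul : ∀ r s, τ (r * s) = τ r * τ s := fun r s => LinearMap.ext fun v => by
    have : (γ (r * s))⁻¹ = (γ r)⁻¹ * (γ s)⁻¹ * α r s := by
      have := hγα r s
      have h1 := hγ0 r
      have h2 := hγ0 s
      have h3 := hγ0 (r * s)
      field_simp
      rw [this, mul_comm]
    simp only [τ, LinearMap.smul_apply, Module.End.mul_apply, map_smul, LinearEquiv.coe_coe, hα,
      this, smul_smul]
    ring_nf
  refine ⟨{ toFun := τ, map_mul' := hmul, map_one' := LinearMap.ext fun v => ?_ }, ?_⟩
  · have h1 := congrArg (fun f => f v) (hmul 1 1)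
    simp only [mul_one, Module.End.mul_apply] at h1
    have hinj : Function.Injective (τ 1) := fun x y hxy => by
      simpa [τ, hγ0 1] using hxy
    exact (hinj h1).symm
  · intro t c v
    simp [τ, hM]

end Extension

/-! ### Modules induced from the stabilizer -/

theorem isIrreducible_comp_mulEquiv {F : Type*} [Field F] {H K : Type*} [Group H] [Group K]
    {V : Type*} [AddCommGroup V] [Module F V] {ρ : Representation F H V} (e : K ≃* H)
    (hρ : ρ.IsIrreducible) :
    Representation.IsIrreducible (ρ.comp e.toMonoidHom : Representation F K V) := by
  let f : Subrepresentation (ρ.comp e.toMonoidHom : Representation F K V) ≃o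
      Subrepresentation ρ :=
    { toFun := fun U => ⟨U.toSubmodule, fun h x hx => by
        simpa using U.apply_mem_toSubmodule (e.symm h) hx⟩
      invFun := fun U => ⟨U.toSubmodule, fun h x hx => U.apply_mem_toSubmodule (e h) hx⟩
      left_inv := fun U => rfl
      right_inv := fun U => rfl
      map_rel_iff' := Iff.rfl }
  exact f.isSimpleOrder

theorem normRank_congr {F : Type*} [Field F] {S : Type*} [Group S] [Finite S]
    {M N : Type*} [AddCommGroup M] [Module F M] [AddCommGroup N] [Module F N]
    {σ : Representation F S M} {τ : Representation F S N} (e : σ.Equiv τ) :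
    normRank σ = normRank τ := by
  have h : LinearMap.range (normMap τ) =
      (LinearMap.range (normMap σ)).map e.toLinearEquiv.toLinearMap := by
    ext y
    constructor
    · rintro ⟨x, rfl⟩
      refine ⟨_, ⟨e.symm x, rfl⟩, ?_⟩
      have := map_normMap e.toIntertwiningMap (e.symm x)
      simpa using! this
    · rintro ⟨_, ⟨x, rfl⟩, rfl⟩
      exact ⟨e x, (map_normMap e.toIntertwiningMap x).symm⟩
  rw [normRank, normRank, h]
  exact (LinearEquiv.finrank_map_eq e.toLinearEquiv _).symm

/-- In a module that embeds into a finite product of pairwise non-isomorphic simple modules, a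
nonzero submodule contains a nonzero vector supported on one factor, namely any nonzero vector of
minimal support: it generates a submodule isomorphic to each factor in its support. -/
theorem exists_mem_supported_on_one {F C W : Type*} [Field F] [Group C] [AddCommGroup W]
    [Module F W] {σ : Representation F C W} {κ : Type*} [Finite κ] {V : κ → Type*}
    [∀ i, AddCommGroup (V i)] [∀ i, Module F (V i)] {ρ : ∀ i, Representation F C (V i)}
    (hρ : ∀ i, (ρ i).IsIrreducible) (hne : Pairwise fun i k => IsEmpty ((ρ i).Equiv (ρ k)))
    (f : ∀ i, σ.IntertwiningMap (ρ i)) (hf : ∀ w, (∀ i, f i w = 0) → w = 0)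
    (U : Submodule F W) (hU : ∀ c, ∀ u ∈ U, σ c u ∈ U) (hU0 : U ≠ ⊥) :
    ∃ u ∈ U, ∃ i, f i u ≠ 0 ∧ ∀ k, k ≠ i → f k u = 0 := by
  classical
  have := Fintype.ofFinite κ
  let supp : W → Finset κ := fun w => Finset.univ.filter fun i => f i w ≠ 0
  obtain ⟨u, ⟨huU, hu0⟩, hmin⟩ := exists_minimalFor_of_wellFoundedLT
    (fun w => w ∈ U ∧ w ≠ 0) (fun w => (supp w).card) (U.exists_mem_ne_zero_of_ne_bot hU0)
  obtain ⟨i, hi⟩ : ∃ i, f i u ≠ 0 := by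
    by_contra! h
    exact hu0 (hf u h)
  refine ⟨u, huU, i, hi, fun k hki => ?_⟩
  by_contra hk
  let N : Subrepresentation σ :=
    { toSubmodule := Submodule.span F (Set.range fun c => σ c u)
      apply_mem_toSubmodule := fun c v hv => by
        induction hv using Submodule.span_induction with
        | mem x hx =>
          obtain ⟨d, rfl⟩ := hx
          exact Submodule.subset_span ⟨c * d, by simp⟩
        | zero => simp
        | add x y _ _ hx hy => rw [map_add]; exact Submodule.add_mem _ hx hy
        | smul a x _ hx => rw [map_smul]; exact Submodule.smul_mem _ a hx }
  have huN : u ∈ N.toSubmodule := Submodule.subset_span ⟨1, by simp⟩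
  have hNU : N.toSubmodule ≤ U := Submodule.span_le.mpr (by rintro _ ⟨c, rfl⟩; exact hU c u huU)
  have hNsupp : ∀ m, f m u = 0 → ∀ x ∈ N.toSubmodule, f m x = 0 := fun m hm x hx => by
    induction hx using Submodule.span_induction with
    | mem x hx =>
      obtain ⟨d, rfl⟩ := hx
      rw [(f m).isIntertwining, hm, map_zero]
    | zero => simp
    | add x y _ _ hx hy => rw [map_add, hx, hy, add_zero]
    | smul a x _ hx => rw [map_smul, hx, smul_zero]
  have hinj : ∀ m, f m u ≠ 0 → ∀ x ∈ N.toSubmodule, f m x = 0 → x = 0 := by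
    intro m hm x hx hmx
    by_contra hx0
    have hsub : supp x ⊆ supp u := fun l hl => by
      simp only [supp, Finset.mem_filter, Finset.mem_univ, true_and] at hl ⊢
      exact fun h => hl (hNsupp l h x hx)
    have hle := hmin (j := x) ⟨hNU hx, hx0⟩ (Finset.card_le_card hsub)
    have heq := Finset.eq_of_subset_of_card_le hsub hle
    have : m ∈ supp x := by rw [heq]; simp [supp, hm]
    simp [supp, hmx] at this
  have hequiv : ∀ m, f m u ≠ 0 → Nonempty (N.toRepresentation.Equiv (ρ m)) := by
    intro m hm
    let g : N.toRepresentation.IntertwiningMap (ρ m) :=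
      { toLinearMap := (f m).toLinearMap ∘ₗ N.toSubmodule.subtype
        isIntertwining' := fun c => LinearMap.ext fun x => (f m).isIntertwining _ _ c x }
    have hgi : Function.Injective g := by
      refine (injective_iff_map_eq_zero g).mpr fun x hx => ?_
      exact Subtype.ext (hinj m hm x x.2 hx)
    have hgs : Function.Surjective g := by
      have := hρ m
      refine (Representation.IsIrreducible.surjective_or_eq_zero g).resolve_right fun h => ?_
      exact hm (congrArg (fun g => g ⟨u, huN⟩) h)
    exact ⟨g.ofBijective ⟨hgi, hgs⟩⟩
  obtain ⟨ei⟩ := hequiv i hi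
  obtain ⟨ek⟩ := hequiv k hk
  exact (hne hki).false (ek.symm.trans ei)

section Coinduced

variable {F : Type*} [Field F] {C S T : Type*} [Group C] [Group S] [Group T]
  (act : S →* MulAut C) (j : T →* S) {V : Type*} [AddCommGroup V] [Module F V]
  (ρ : Representation F C V) (τ : Representation F T V)

/-- The functions `f : S → V` with `f (t s) = t (f s)` for `t` in `T`, embedded into `S` by `j`:
the space of the module induced (equivalently, coinduced) from `T` to `S`. -/
def coindSpace : Submodule F (S → V) where
  carrier := {f | ∀ t s, f (j t * s) = τ t (f s)}
  add_mem' hf hg t s := by simp [hf t s, hg t s]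
  zero_mem' t s := by simp
  smul_mem' a f hf t s := by simp [hf t s]

variable {j τ}

theorem coindSpace_apply (f : coindSpace j τ) (t : T) (s : S) :
    f.1 (j t * s) = τ t (f.1 s) := f.2 t s

variable (hτ : ∀ t c v, τ t (ρ c v) = ρ (act (j t) c) (τ t v))

/-- The module of `C ⋊ S` induced from the module of `C ⋊ T` on `V` given by `ρ` and `τ`:
`(c f) s = (s c) (f s)` for `c` in `C`, and `(r f) s = f (s r)` for `r` in `S`. -/
def coind : Representation F (C ⋊[act] S) (coindSpace j τ) where
  toFun x :=
    { toFun := fun f => ⟨fun s => ρ (act s x.left) (f.1 (s * x.right)), fun t s => by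
        beta_reduce
        rw [mul_assoc, coindSpace_apply, hτ, map_mul, MulAut.mul_apply]⟩
      map_add' := fun f g => Subtype.ext (funext fun s => by simp)
      map_smul' := fun a f => Subtype.ext (funext fun s => by simp) }
  map_one' := LinearMap.ext fun f => Subtype.ext (funext fun s => by simp)
  map_mul' x y := LinearMap.ext fun f => Subtype.ext (funext fun s => by simp [mul_assoc])

theorem coind_apply (x : C ⋊[act] S) (f : coindSpace j τ) (s : S) :
    (coind act ρ hτ x f).1 s = ρ (act s x.left) (f.1 (s * x.right)) := rfl

/-- The right cosets of `T` in `S`. -/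
abbrev RightCosets (j : T →* S) : Type _ := Quotient (QuotientGroup.rightRel j.range)

theorem exists_eq_mul_out (s : S) :
    ∃ t, s = j t * (Quotient.mk (QuotientGroup.rightRel j.range) s).out := by
  have h := Quotient.mk_out (s := QuotientGroup.rightRel j.range) s
  rw [QuotientGroup.rightRel_apply] at h
  obtain ⟨t, ht⟩ := h
  exact ⟨t, by rw [ht]; simp⟩

theorem eq_of_out_eq_mul_out {q q' : RightCosets j} {t : T} (h : q'.out = j t * q.out) :
    q = q' := by
  rw [← q.out_eq, ← q'.out_eq, Quotient.eq, QuotientGroup.rightRel_apply, h]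
  exact ⟨t, by simp⟩

theorem coindSpace_ext {f g : coindSpace j τ} (h : ∀ q : RightCosets j, f.1 q.out = g.1 q.out) :
    f = g := by
  refine Subtype.ext (funext fun s => ?_)
  obtain ⟨t, ht⟩ := exists_eq_mul_out (j := j) s
  rw [ht, coindSpace_apply, coindSpace_apply, h]

variable (hj : Function.Injective j)

open Classical in
/-- The element of the induced module with value `v` at `s₀` and support in the coset `T s₀`. -/
def cosetFun (τ : Representation F T V) (s₀ : S) : V →ₗ[F] coindSpace j τ where
  toFun v := ⟨fun s => if h : ∃ t, s = j t * s₀ then τ h.choose v else 0, fun t s => by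
    beta_reduce
    by_cases h : ∃ r, s = j r * s₀
    · have h' : ∃ r, j t * s = j r * s₀ :=
        ⟨t * h.choose, by rw [map_mul, mul_assoc, ← h.choose_spec]⟩
      have : h'.choose = t * h.choose := hj (mul_right_cancel (b := s₀) (by
        rw [← h'.choose_spec, map_mul, mul_assoc, ← h.choose_spec]))
      rw [dif_pos h, dif_pos h', this, map_mul, Module.End.mul_apply]
    · have h' : ¬∃ r, j t * s = j r * s₀ := fun ⟨r, hr⟩ =>
        h ⟨t⁻¹ * r, by rw [map_mul, mul_assoc, ← hr]; simp⟩
      rw [dif_neg h, dif_neg h', map_zero]⟩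
  map_add' v w := Subtype.ext (funext fun s => by
    by_cases h : ∃ t, s = j t * s₀ <;> simp [h])
  map_smul' a v := Subtype.ext (funext fun s => by
    by_cases h : ∃ t, s = j t * s₀ <;> simp [h])

theorem cosetFun_apply (s₀ : S) (v : V) (t : T) :
    (cosetFun hj τ s₀ v).1 (j t * s₀) = τ t v := by
  have h : ∃ r, j t * s₀ = j r * s₀ := ⟨t, rfl⟩
  have : h.choose = t := hj (mul_right_cancel h.choose_spec.symm)
  exact (dif_pos h).trans (by rw [this])

theorem cosetFun_self (s₀ : S) (v : V) : (cosetFun hj τ s₀ v).1 s₀ = v := by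
  simpa using cosetFun_apply hj (τ := τ) s₀ v 1

theorem cosetFun_of_ne (s₀ : S) (v : V) {s : S} (h : ∀ t, s ≠ j t * s₀) :
    (cosetFun hj τ s₀ v).1 s = 0 :=
  dif_neg (not_exists.mpr h)

theorem eq_cosetFun (s₀ : S) (f : coindSpace j τ) (h : ∀ s, (∀ t, s ≠ j t * s₀) → f.1 s = 0) :
    f = cosetFun hj τ s₀ (f.1 s₀) := by
  refine Subtype.ext (funext fun s => ?_)
  by_cases hs : ∃ t, s = j t * s₀
  · obtain ⟨t, rfl⟩ := hs
    rw [cosetFun_apply, coindSpace_apply]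
  · push Not at hs
    rw [h s hs, cosetFun_of_ne hj s₀ _ hs]

theorem sum_cosetFun [Finite S] (f : coindSpace j τ) :
    letI := Fintype.ofFinite (RightCosets j)
    ∑ q : RightCosets j, cosetFun hj τ q.out (f.1 q.out) = f := by
  let _ := Fintype.ofFinite (RightCosets j)
  refine coindSpace_ext fun q => ?_
  have : ((∑ q : RightCosets j, cosetFun hj τ q.out (f.1 q.out) : coindSpace j τ)).1 =
      ∑ q : RightCosets j, (cosetFun hj τ q.out (f.1 q.out)).1 :=
    map_sum (coindSpace j τ).subtype _ _
  rw [this, Finset.sum_apply, Finset.sum_eq_single q, cosetFun_self]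
  · intro q' _ hq'
    exact cosetFun_of_ne hj _ _ fun t h => hq' (eq_of_out_eq_mul_out h)
  · simp

theorem coind_inl_cosetFun (s₀ : S) (c : C) (v : V) :
    coind act ρ hτ (SemidirectProduct.inl c) (cosetFun hj τ s₀ v) =
      cosetFun hj τ s₀ (ρ (act s₀ c) v) := by
  rw [eq_cosetFun hj s₀ (coind act ρ hτ (SemidirectProduct.inl c) (cosetFun hj τ s₀ v))]
  · simp [coind_apply, cosetFun_self]
  · intro s hs
    simp [coind_apply, cosetFun_of_ne hj s₀ v hs]

theorem coind_inr_cosetFun (s₀ s : S) (v : V) :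
    coind act ρ hτ (SemidirectProduct.inr s) (cosetFun hj τ s₀ v) =
      cosetFun hj τ (s₀ * s⁻¹) v := by
  rw [eq_cosetFun hj (s₀ * s⁻¹) (coind act ρ hτ (SemidirectProduct.inr s) (cosetFun hj τ s₀ v))]
  · simp [coind_apply, cosetFun_self]
  · intro r hr
    simp only [coind_apply, SemidirectProduct.left_inr, SemidirectProduct.right_inr, map_one,
      Module.End.one_apply]
    exact cosetFun_of_ne hj s₀ v fun t h => hr t (by rw [← mul_assoc, ← h]; simp)

/-- Evaluation at `s`, as a map of modules for `C`. -/
def coindEval (s : S) : Representation.IntertwiningMap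
    ((coind act ρ hτ).comp (SemidirectProduct.inl : C →* C ⋊[act] S))
    (twist (act s⁻¹) ρ) where
  toLinearMap := LinearMap.proj s ∘ₗ (coindSpace j τ).subtype
  isIntertwining' c := LinearMap.ext fun f => by
    simp [coind_apply, twist]

/-- An isomorphism between two twists of `ρ` is an isomorphism of `ρ` with a twist of it. -/
def twistEquiv {a b : MulAut C} (e : (twist a ρ).Equiv (twist b ρ)) :
    (twist (b⁻¹ * a) ρ).Equiv ρ :=
  Representation.Equiv.mk e.toLinearEquiv fun c => LinearMap.ext fun v => by
    have := e.toIntertwiningMap.isIntertwining _ _ (b c) v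
    simpa [twist] using! this

theorem pairwise_isEmpty_equiv
    (hstab : ∀ s, Nonempty ((twist (act s) ρ).Equiv ρ) → s ∈ j.range) : Pairwise fun q q' : RightCosets j =>
    IsEmpty ((twist (act q.out⁻¹) ρ).Equiv (twist (act q'.out⁻¹) ρ)) := by
  intro q q' hne
  refine ⟨fun e => hne ?_⟩
  obtain ⟨t, ht⟩ := hstab (q'.out * q.out⁻¹) ⟨by
    have := twistEquiv ρ e
    rwa [← map_inv, ← map_mul, inv_inv] at this⟩
  exact eq_of_out_eq_mul_out (t := t) (by rw [ht]; simp)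

/-- If `T` is the full stabilizer of the simple module `ρ`, then the induced module is simple. -/
theorem isIrreducible_coind [Finite S] (hj : Function.Injective j)
    (hstab : ∀ s, Nonempty ((twist (act s) ρ).Equiv ρ) → s ∈ j.range) (hρ : ρ.IsIrreducible) :
    (coind act ρ hτ).IsIrreducible := by
  have hV := nontrivial_of_isIrreducible hρ
  have hnt : Nontrivial (Subrepresentation (coind act ρ hτ)) := by
    obtain ⟨v, hv⟩ := exists_ne (0 : V)
    refine ⟨⊥, ⊤, fun h => hv ?_⟩
    have hmem : cosetFun hj τ 1 v ∈ (⊥ : Subrepresentation (coind act ρ hτ)).toSubmodule := by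
      rw [h]; exact Submodule.mem_top
    have h0 : cosetFun hj τ 1 v = 0 := hmem
    rw [← cosetFun_self hj (τ := τ) 1 v, h0]
    rfl
  refine ⟨fun U => ?_⟩
  by_cases hU : U.toSubmodule = ⊥
  · exact Or.inl (Subrepresentation.toSubmodule_injective hU)
  refine Or.inr (Subrepresentation.toSubmodule_injective (eq_top_iff.mpr fun f _ => ?_))
  obtain ⟨u, huU, q, hq, hq'⟩ := exists_mem_supported_on_one
    (σ := (coind act ρ hτ).comp (SemidirectProduct.inl : C →* C ⋊[act] S))
    (ρ := fun q : RightCosets j => twist (act q.out⁻¹) ρ)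
    (fun _ => isIrreducible_comp_mulEquiv _ hρ) (pairwise_isEmpty_equiv act ρ hstab)
    (fun q => coindEval act ρ hτ q.out) (fun w hw => coindSpace_ext hw) U.toSubmodule
    (fun c u hu => U.apply_mem_toSubmodule _ hu) hU
  have hu : u = cosetFun hj τ q.out (u.1 q.out) := by
    refine eq_cosetFun hj _ u fun s hs => ?_
    obtain ⟨t, ht⟩ := exists_eq_mul_out (j := j) s
    rw [ht, coindSpace_apply]
    have : u.1 (Quotient.mk (QuotientGroup.rightRel j.range) s).out = 0 :=
      hq' _ fun h => hs t (by rw [← h]; exact ht)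
    rw [this, map_zero]
  -- The values at the representative `q.out` of functions in `U` supported on its coset form a
  -- submodule of `ρ`, since `ρ` and its twists have the same submodules.
  let X : Subrepresentation ρ :=
    { toSubmodule := U.toSubmodule.comap (cosetFun hj τ q.out)
      apply_mem_toSubmodule := fun c v hv => by
        have := U.apply_mem_toSubmodule (SemidirectProduct.inl (act q.out⁻¹ c)) hv
        rw [coind_inl_cosetFun] at this
        simpa using this }
  have hX : X = ⊤ := by
    refine (hρ.eq_bot_or_eq_top X).resolve_left fun h => hq ?_
    have : u.1 q.out ∈ X.toSubmodule := by
      change cosetFun hj τ q.out (u.1 q.out) ∈ U.toSubmodule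
      rwa [← hu]
    rw [h] at this
    exact this
  have hall : ∀ s v, cosetFun hj τ s v ∈ U.toSubmodule := fun s v => by
    have hv : v ∈ X.toSubmodule := by rw [hX]; exact Submodule.mem_top
    have := U.apply_mem_toSubmodule (SemidirectProduct.inr (s⁻¹ * q.out)) hv
    rw [coind_inr_cosetFun] at this
    simpa using this
  rw [← sum_cosetFun hj f]
  exact Submodule.sum_mem _ fun q _ => hall _ _

/-- The norm of `S` sends `f` to the constant function `∑ s, f s`, and these sums run through the
range of the norm of `T` on `τ`. -/
theorem normRank_coind [Finite S] [Finite T] [FiniteDimensional F V]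
    (hj : Function.Injective j) :
    normRank (resS (coind act ρ hτ)) = normRank τ := by
  have := Fintype.ofFinite S
  have := Fintype.ofFinite T
  let N := normMap (resS (coind act ρ hτ))
  have hN : ∀ f s, (N f).1 s = ∑ r, f.1 r := fun f s => by
    have h1 : (N f).1 = ∑ r, (resS (coind act ρ hτ) r f).1 := by
      rw [normMap_apply]
      exact map_sum (coindSpace j τ).subtype _ _
    rw [h1, Finset.sum_apply]
    exact Fintype.sum_bijective (s * ·) (Group.mulLeft_bijective s) _ _ fun r => by
      simp [coind_apply]
  let ev : coindSpace j τ →ₗ[F] V := LinearMap.proj 1 ∘ₗ (coindSpace j τ).subtype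
  have hev : ∀ s₀ v, ev (N (cosetFun hj τ s₀ v)) = normMap τ v := fun s₀ v => by
    rw [normMap_apply τ]
    refine (hN _ 1).trans (Fintype.sum_of_injective (fun t => j t * s₀)
      (fun a b h => hj (mul_right_cancel h)) _ _ (fun s hs => ?_) fun t => ?_).symm
    · exact cosetFun_of_ne hj s₀ v fun t h => hs ⟨t, h.symm⟩
    · exact (cosetFun_apply hj s₀ v t).symm
  have hrange : LinearMap.range (ev ∘ₗ N) = LinearMap.range (normMap τ) := by
    apply le_antisymm
    · rintro _ ⟨f, rfl⟩
      rw [← sum_cosetFun hj f, map_sum]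
      exact Submodule.sum_mem _ fun q _ => ⟨f.1 q.out, (hev _ _).symm⟩
    · rintro _ ⟨v, rfl⟩
      exact ⟨cosetFun hj τ 1 v, hev 1 v⟩
  have hker : LinearMap.ker (ev ∘ₗ N) = LinearMap.ker N := by
    apply le_antisymm
    · intro f hf
      have h1 : (N f).1 1 = 0 := hf
      rw [hN] at h1
      exact Subtype.ext (funext fun s => (hN f s).trans h1)
    · exact LinearMap.ker_le_ker_comp N ev
  have h1 := LinearMap.finrank_range_add_finrank_ker (ev ∘ₗ N)
  have h2 := LinearMap.finrank_range_add_finrank_ker N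
  rw [hrange, hker] at h1
  simp only [normRank]
  change Module.finrank F (LinearMap.range N) = _
  omega

end Coinduced

/-! ### Simple modules lying over a given one -/

section LiesOver

variable {F : Type*} [Field F] {C S T : Type*} [Group C] [Group S] [Group T]
  {act : S →* MulAut C} {j : T →* S} {V : Type*} [AddCommGroup V] [Module F V]
  {ρ : Representation F C V} {τ : Representation F T V}
  {W : Type*} [AddCommGroup W] [Module F W] {ξ : Representation F (C ⋊[act] S) W}

/-- Frobenius reciprocity: a map `g` of modules for `C` and `T` gives the map
`w ↦ (s ↦ g (s w))` to the induced module. -/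
def toCoind (hτ : ∀ t c v, τ t (ρ c v) = ρ (act (j t) c) (τ t v)) (g : W →ₗ[F] V)
    (hC : ∀ c w, g (ξ (SemidirectProduct.inl c) w) = ρ c (g w))
    (hT : ∀ t w, g (ξ (SemidirectProduct.inr (j t)) w) = τ t (g w)) :
    ξ.IntertwiningMap (coind act ρ hτ) where
  toLinearMap :=
    { toFun := fun w => ⟨fun s => g (ξ (SemidirectProduct.inr s) w), fun t s => by
        beta_reduce
        rw [map_mul, map_mul, Module.End.mul_apply, hT]⟩
      map_add' := fun x y => Subtype.ext (funext fun s => by simp)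
      map_smul' := fun a x => Subtype.ext (funext fun s => by simp) }
  isIntertwining' x := LinearMap.ext fun w => Subtype.ext (funext fun s => by
    have h : SemidirectProduct.inr s * x =
        SemidirectProduct.inl (act s x.left) * SemidirectProduct.inr (s * x.right) := by
      ext <;> simp
    change g (ξ (SemidirectProduct.inr s) (ξ x w)) =
      ρ (act s x.left) (g (ξ (SemidirectProduct.inr (s * x.right)) w))
    rw [← Module.End.mul_apply, ← map_mul, h, map_mul, Module.End.mul_apply, hC])

variable {p : ℕ} [Fact p.Prime] [CharP F p]

/-- A simple module `W` with a nonzero map to `ρ` over `C` is isomorphic to the induced module: the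
`p`-group `T` acts on the nonzero space of such maps, hence fixes a nonzero one. -/
theorem nonempty_equiv_coind [Finite S] [Finite T] (hT : IsPGroup p T)
    (hτ : ∀ t c v, τ t (ρ c v) = ρ (act (j t) c) (τ t v)) (hj : Function.Injective j)
    (hstab : ∀ s, Nonempty ((twist (act s) ρ).Equiv ρ) → s ∈ j.range) (hρ : ρ.IsIrreducible)
    (hξ : ξ.IsIrreducible) (g : W →ₗ[F] V) (hg : g ≠ 0)
    (hC : ∀ c w, g (ξ (SemidirectProduct.inl c) w) = ρ c (g w)) :
    Nonempty (ξ.Equiv (coind act ρ hτ)) := by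
  let U : Submodule F (W →ₗ[F] V) :=
    { carrier := {f | ∀ c w, f (ξ (SemidirectProduct.inl c) w) = ρ c (f w)}
      add_mem' := fun hf hg c w => by simp [hf c w, hg c w]
      zero_mem' := fun c w => by simp
      smul_mem' := fun a f hf c w => by simp [hf c w] }
  let σ : Representation F T (W →ₗ[F] V) :=
    Representation.linHom ((resS ξ).comp j) τ
  have hσ : ∀ t f w, σ t f w = τ t (f (ξ (SemidirectProduct.inr (j t)⁻¹) w)) := fun t f w => by
    simp [σ, Representation.linHom_apply]
  obtain ⟨f, hfU, hf0, hf⟩ := exists_ne_zero_fixed hT σ U (fun t f hf c w => by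
    have h : (SemidirectProduct.inr (j t)⁻¹ * SemidirectProduct.inl c : C ⋊[act] S) =
        SemidirectProduct.inl (act (j t)⁻¹ c) * SemidirectProduct.inr (j t)⁻¹ := by
      ext <;> simp
    rw [hσ, hσ, ← Module.End.mul_apply, ← map_mul, h, map_mul, Module.End.mul_apply, hf, hτ]
    simp) ((Submodule.ne_bot_iff _).mpr ⟨g, hC, hg⟩)
  have hfT : ∀ t w, f (ξ (SemidirectProduct.inr (j t)) w) = τ t (f w) := fun t w => by
    have := congrArg (fun f => f (ξ (SemidirectProduct.inr (j t)) w)) (hf t)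
    simp only [hσ] at this
    rw [← this, ← Module.End.mul_apply (ξ _), ← map_mul, ← map_mul]
    simp
  have hI := isIrreducible_coind act ρ hτ hj hstab hρ
  have hne : toCoind hτ f hfU hfT ≠ 0 := fun h => hf0 (LinearMap.ext fun w => by
    have h1 : (toCoind hτ f hfU hfT w).1 1 = 0 := by rw [h]; rfl
    have h2 : (toCoind hτ f hfU hfT w).1 1 = f (ξ (SemidirectProduct.inr 1) w) := rfl
    rw [h2] at h1
    simpa using h1)
  exact ⟨(toCoind hτ f hfU hfT).ofBijective
    ((Representation.IsIrreducible.bijective_or_eq_zero _).resolve_right hne)⟩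

/-- Restriction along a homomorphism of groups preserves isomorphisms. -/
def compEquiv {F H K V W : Type*} [Field F] [Group H] [Group K] [AddCommGroup V] [Module F V]
    [AddCommGroup W] [Module F W] {ρ : Representation F H V} {σ : Representation F H W}
    (e : ρ.Equiv σ) (f : K →* H) :
    Representation.Equiv (ρ.comp f : Representation F K V) (σ.comp f : Representation F K W) :=
  Representation.Equiv.mk e.toLinearEquiv fun k => e.isIntertwining' (f k)

/-- The rank of `∑ s` on a simple module of `C ⋊ S` over `ρ` is already seen on the
extension of `ρ` to the stabilizer `T`. -/
theorem normRank_resS_eq [Finite S] [Finite T] [FiniteDimensional F V] (hT : IsPGroup p T)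
    (hτ : ∀ t c v, τ t (ρ c v) = ρ (act (j t) c) (τ t v)) (hj : Function.Injective j)
    (hstab : ∀ s, Nonempty ((twist (act s) ρ).Equiv ρ) → s ∈ j.range) (hρ : ρ.IsIrreducible)
    (hξ : ξ.IsIrreducible) (g : W →ₗ[F] V) (hg : g ≠ 0)
    (hC : ∀ c w, g (ξ (SemidirectProduct.inl c) w) = ρ c (g w)) :
    normRank (resS ξ) = normRank τ := by
  obtain ⟨e⟩ := nonempty_equiv_coind hT hτ hj hstab hρ hξ g hg hC
  rw [normRank_congr (compEquiv e SemidirectProduct.inr), normRank_coind act ρ hτ hj]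

/-- The restriction to `C` of the induced module is the direct sum of the twists of `ρ` by
representatives of the cosets of the stabilizer. -/
def coindEquivDirectSum [Finite S] [Finite T] (hj : Function.Injective j)
    (hτ : ∀ t c v, τ t (ρ c v) = ρ (act (j t) c) (τ t v)) {n : ℕ} (e : Fin n ≃ RightCosets j) :
    Representation.Equiv
      ((coind act ρ hτ).comp (SemidirectProduct.inl : C →* C ⋊[act] S))
      (Representation.directSum fun i : Fin n => twist (act (e i).out⁻¹) ρ) :=
  Representation.Equiv.mk
    ((LinearEquiv.ofBijective (LinearMap.pi fun i : Fin n =>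
      (coindEval act ρ hτ (e i).out).toLinearMap) ⟨fun f g h => coindSpace_ext fun q => by
        have := congrFun h (e.symm q)
        simpa [coindEval] using this, fun v => by
        refine ⟨∑ i, cosetFun hj τ (e i).out (v i), funext fun k => ?_⟩
        rw [map_sum, Finset.sum_apply, Finset.sum_eq_single k]
        · exact cosetFun_self hj _ _
        · intro i _ hik
          exact cosetFun_of_ne hj _ _ fun t h => hik (e.injective (eq_of_out_eq_mul_out h))
        · simp⟩).trans
    (DirectSum.linearEquivFunOnFintype F (Fin n) fun _ => V).symm) fun c => by
      refine LinearMap.ext fun f => (DirectSum.linearEquivFunOnFintype F (Fin n) fun _ => V).injective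
        (funext fun k => ?_)
      have := (coindEval act ρ hτ (e k).out).isIntertwining _ _ c f
      simpa using! this

end LiesOver

section Stabilizer

/-- Twisting an isomorphism of representations. -/
def twistCongr {F C V W : Type*} [Field F] [Group C] [AddCommGroup V] [Module F V]
    [AddCommGroup W] [Module F W] {ρ : Representation F C V} {σ : Representation F C W}
    (a : MulAut C) (e : ρ.Equiv σ) : (twist a ρ).Equiv (twist a σ) :=
  compEquiv e _

/-- The stabilizer in `S` of the isomorphism class of a module for `C`. -/
def isoStabilizer {F C S V : Type*} [Field F] [Group C] [Group S] [AddCommGroup V] [Module F V]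
    (act : S →* MulAut C) (ρ : Representation F C V) : Subgroup S where
  carrier := {s | Nonempty ((twist (act s) ρ).Equiv ρ)}
  one_mem' := ⟨Representation.Equiv.mk (LinearEquiv.refl F V) fun c => by
    ext v; simp [twist]⟩
  mul_mem' := by
    rintro s t ⟨e⟩ ⟨f⟩
    refine ⟨Representation.Equiv.trans (Representation.Equiv.mk (LinearEquiv.refl F V) fun c => ?_)
      ((twistCongr (act s) f).trans e)⟩
    ext v
    simp [twist]
  inv_mem' := by
    rintro s ⟨e⟩
    refine ⟨Representation.Equiv.trans (twistCongr (act s⁻¹) e.symm)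
      (Representation.Equiv.mk (LinearEquiv.refl F V) fun c => ?_)⟩
    ext v
    simp [twist]

end Stabilizer

section Semidirect

variable {p : ℕ} {F : Type u} {L : Type v} [Field F] [Field L]
  {ι : CommGroup.torsion Fˣ →* CommGroup.torsion Lˣ} {C S : Type w} [Group C] [Group S]

theorem finite_semidirectProduct [Finite C] [Finite S] (act : S →* MulAut C) :
    Finite (C ⋊[act] S) :=
  Finite.of_equiv _ SemidirectProduct.equivProd.symm

/-- A module lying over `V(η)` has a nonzero `C`-map to `V(η)`: project to a summand, which is a
conjugate `ˢV(η)`, after acting by `s`. -/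
theorem exists_map_of_liesOver {act : S →* MulAut C} {η : Irr p ι C} {ξ : Irr p ι (C ⋊[act] S)}
    (h : LiesOver act η ξ) {W : Type*} [AddCommGroup W] [Module F W]
    {σ : Representation F (C ⋊[act] S) W} (e : σ.Equiv ξ.V) :
    ∃ g : W →ₗ[F] (Fin η.dim → F), g ≠ 0 ∧
      ∀ c w, g (σ (SemidirectProduct.inl c) w) = η.V c (g w) := by
  obtain ⟨n, s, -, ⟨d⟩⟩ := h
  have hnt : Nontrivial (Fin ξ.dim → F) := nontrivial_of_isIrreducible ξ.V_irreducible
  obtain ⟨x, hx⟩ := exists_ne (0 : Fin ξ.dim → F)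
  obtain ⟨i, hi⟩ : ∃ i, d x i ≠ 0 := by
    by_contra! h0
    have h1 : d x = 0 := DFinsupp.ext h0
    have h2 : d.toLinearEquiv x = 0 := h1
    exact hx (by simpa using h2)
  let π : (Fin ξ.dim → F) →ₗ[F] (Fin η.dim → F) :=
    DirectSum.component F (Fin n) _ i ∘ₗ d.toLinearEquiv.toLinearMap
  have hπ : ∀ c y, π (ξ.V (SemidirectProduct.inl c) y) = η.V ((act (s i))⁻¹ c) (π y) := by
    intro c y
    have h1 := d.toIntertwiningMap.isIntertwining _ _ c y
    have h2 := congrArg (DirectSum.component F (Fin n) _ i) h1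
    simpa [π, twist] using! h2
  let g : W →ₗ[F] (Fin η.dim → F) :=
    π ∘ₗ ξ.V (SemidirectProduct.inr (s i)) ∘ₗ e.toLinearEquiv.toLinearMap
  have hg : ∀ w, g w = π (ξ.V (SemidirectProduct.inr (s i)) (e w)) := fun _ => rfl
  refine ⟨g, fun h0 => hi ?_, fun c w => ?_⟩
  · have h1 : g (e.symm (ξ.V (SemidirectProduct.inr (s i)⁻¹) x)) = 0 := by rw [h0]; rfl
    rw [hg, e.apply_symm_apply, ← Module.End.mul_apply, ← map_mul, ← map_mul] at h1
    simpa [π] using! h1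
  · have h1 : e (σ (SemidirectProduct.inl c) w) = ξ.V (SemidirectProduct.inl c) (e w) :=
      e.toIntertwiningMap.isIntertwining _ _ _ _
    have h2 : (SemidirectProduct.inr (s i) * SemidirectProduct.inl c : C ⋊[act] S) =
        SemidirectProduct.inl (act (s i) c) * SemidirectProduct.inr (s i) := by
      ext <;> simp
    rw [hg, hg, h1, ← Module.End.mul_apply, ← map_mul, h2, map_mul, Module.End.mul_apply, hπ]
    simp

theorem brauerChar_twist {V : Type*} [AddCommGroup V] [Module F V] [FiniteDimensional F V]
    (a : MulAut C) (ρ : Representation F C V) (c : PRegular p C) :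
    brauerChar p ι (twist a ρ) c =
      brauerChar p ι ρ ⟨a⁻¹ c.1, by rw [MulEquiv.orderOf_eq]; exact c.2⟩ := rfl

theorem brauerChar_comap {C' : Type w} [Group C'] (θ : C' ≃* C) (η : Irr p ι C) :
    brauerChar p ι (η.V.comp θ.toMonoidHom : Representation F C' _) = (η.comap θ).1 :=
  funext fun c => congrFun η.brauerChar_V ⟨θ c.1, by rw [MulEquiv.orderOf_eq]; exact c.2⟩

end Semidirect

section Existence

variable {p : ℕ} [Fact p.Prime] {F : Type u} {L : Type v} [Field F] [IsAlgClosed F] [CharP F p]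
  [Field L] [CharZero L] {ι : CommGroup.torsion Fˣ →* CommGroup.torsion Lˣ}
  {C S : Type w} [Group C] [Group S] [Finite C] [Finite S]

/-- Every simple module is `V(χ)` for an irreducible character `χ`, up to isomorphism. -/
theorem exists_irr_equiv (hι : Function.Injective ι) {W : Type*} [AddCommGroup W] [Module F W]
    [FiniteDimensional F W] {σ : Representation F C W} (hσ : σ.IsIrreducible) :
    ∃ χ : Irr p ι C, Nonempty (χ.V.Equiv σ) := by
  let e : W ≃ₗ[F] (Fin (Module.finrank F W) → F) := (Module.finBasis F W).equivFun
  let σ' : Representation F C (Fin (Module.finrank F W) → F) :=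
    { toFun := fun c => e.conj (σ c)
      map_one' := by rw [map_one]; exact LinearEquiv.conj_id e
      map_mul' := fun c d => by rw [map_mul]; exact LinearEquiv.conj_comp e _ _ }
  let E : σ.Equiv σ' := Representation.Equiv.mk e fun c => LinearMap.ext fun w => by
    simp [σ', LinearEquiv.conj_apply]
  have hσ' : σ'.IsIrreducible := by
    let f : Subrepresentation σ' ≃o Subrepresentation σ :=
      { toFun := fun U => ⟨U.toSubmodule.comap e.toLinearMap, fun c x hx => by
          have := U.apply_mem_toSubmodule c hx
          simpa [σ', LinearEquiv.conj_apply] using this⟩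
        invFun := fun U => ⟨U.toSubmodule.comap e.symm.toLinearMap, fun c x hx => by
          have := U.apply_mem_toSubmodule c hx
          simpa [σ', LinearEquiv.conj_apply] using this⟩
        left_inv := fun U => Subrepresentation.toSubmodule_injective (by ext; simp)
        right_inv := fun U => Subrepresentation.toSubmodule_injective (by ext; simp)
        map_rel_iff' := by
          intro U U'
          exact Submodule.comap_le_comap_iff_of_surjective (f := e.toLinearMap) e.surjective }
    exact f.isSimpleOrder
  let χ : Irr p ι C := ⟨brauerChar p ι σ, _, σ', hσ', (brauerChar_congr E).symm⟩
  exact ⟨χ, nonempty_equiv_of_brauerChar_eq hι χ.V_irreducible hσ χ.brauerChar_V⟩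

/-- Existence of `η_{⋊S}`: the module induced from an extension of `V(η)` to its stabilizer. -/
theorem exists_liesOver (hι : Function.Injective ι) (hS : IsPGroup p S) (act : S →* MulAut C)
    (η : Irr p ι C) : ∃ ξ, LiesOver act η ξ := by
  let T := isoStabilizer act η.V
  obtain ⟨τ, hτ⟩ := exists_extension (hS.to_subgroup T) (act.comp T.subtype) η.V_irreducible
    fun t => t.2
  have hj : Function.Injective T.subtype := T.subtype_injective
  have hstab : ∀ s, Nonempty ((twist (act s) η.V).Equiv η.V) → s ∈ T.subtype.range :=
    fun s hs => by rw [T.range_subtype]; exact hs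
  have := finite_semidirectProduct act
  obtain ⟨ξ, ⟨e⟩⟩ := exists_irr_equiv hι
    (isIrreducible_coind act η.V hτ hj hstab η.V_irreducible)
  let k := (Finite.equivFin (RightCosets T.subtype)).symm
  refine ⟨ξ, _, fun i => (k i).out⁻¹, fun i i' hii' => ?_, ⟨?_⟩⟩
  · exact pairwise_isEmpty_equiv act η.V hstab (k.injective.ne hii')
  · exact (compEquiv e SemidirectProduct.inl).trans (coindEquivDirectSum hj hτ k)

theorem liesOver_semidirectChar (hι : Function.Injective ι) (hS : IsPGroup p S)
    (act : S →* MulAut C) (η : Irr p ι C) : LiesOver act η (semidirectChar act η) :=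
  Classical.epsilon_spec (exists_liesOver hι hS act η)

/-- The rank of the norm on `V(η_{⋊S})` is that on the extension to the stabilizer of the module
`V(ᶿη)`, where `ᶿη` is the transport of `η` along compatible isomorphisms of `C` and `S`. -/
theorem normRank_semidirectChar_of_mulEquiv (hι : Function.Injective ι) (hS : IsPGroup p S)
    {C' S' : Type w} [Group C'] [Group S'] [Finite C']
    {act : S →* MulAut C} {act' : S' →* MulAut C'} (θ : C' ≃* C) (κ : S ≃* S')
    (hθκ : ∀ s c, θ (act' (κ s) c) = act s (θ c)) (η : Irr p ι C)
    {T : Type*} [Group T] [Finite T] (hT : IsPGroup p T) {j : T →* S'} (hj : Function.Injective j)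
    (hstab : ∀ s, Nonempty ((twist (act' s) (η.comap θ).V).Equiv (η.comap θ).V) → s ∈ j.range)
    {τ : Representation F T (Fin (η.comap θ).dim → F)}
    (hτ : ∀ t c v, τ t ((η.comap θ).V c v) = (η.comap θ).V (act' (j t) c) (τ t v)) :
    normRank (resS (semidirectChar act η).V) = normRank τ := by
  let η' := η.comap θ
  let ρ : Representation F C (Fin η'.dim → F) := η'.V.comp θ.symm.toMonoidHom
  have hρ : ∀ c v, ρ c v = η'.V (θ.symm c) v := fun _ _ => rfl
  obtain ⟨e⟩ := nonempty_equiv_of_brauerChar_eq (p := p) hι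
    (isIrreducible_comp_mulEquiv θ η.V_irreducible) η'.V_irreducible
    ((brauerChar_comap θ η).trans η'.brauerChar_V.symm)
  obtain ⟨g, hg, hC⟩ := exists_map_of_liesOver (liesOver_semidirectChar hι hS act η)
    (Representation.Equiv.refl _)
  refine normRank_resS_eq (p := p) (ρ := ρ) (j := κ.symm.toMonoidHom.comp j) hT
    (fun t c v => ?_) (κ.symm.injective.comp hj) (fun s hs => ?_)
    (isIrreducible_comp_mulEquiv θ.symm η'.V_irreducible) (Irr.V_irreducible _)
    (e.toLinearEquiv.toLinearMap ∘ₗ g) (fun h => hg ?_) fun c w => ?_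
  · have h : act' (j t) (θ.symm c) = θ.symm (act (κ.symm (j t)) c) := by
      apply θ.injective
      have := hθκ (κ.symm (j t)) (θ.symm c)
      simpa using this
    rw [hρ, hρ, hτ, h]
    rfl
  · obtain ⟨f⟩ := hs
    obtain ⟨t, ht⟩ := hstab (κ s)
      ⟨Representation.Equiv.mk f.toLinearEquiv fun c => LinearMap.ext fun v => by
        have h1 := f.toIntertwiningMap.isIntertwining _ _ (θ c) v
        have h2 : θ.symm ((act s)⁻¹ (θ c)) = (act' (κ s))⁻¹ c := by
          rw [MulEquiv.symm_apply_eq]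
          have := hθκ s ((act' (κ s))⁻¹ c)
          rw [MulAut.apply_inv_self] at this
          rw [this, MulAut.inv_apply_self]
        have h3 : f (η'.V (θ.symm ((act s)⁻¹ (θ c))) v) = η'.V (θ.symm (θ c)) (f v) := h1
        rw [h2, θ.symm_apply_apply] at h3
        exact h3⟩
    exact ⟨t, by simp [ht]⟩
  · refine LinearMap.ext fun w => ?_
    exact e.toLinearEquiv.map_eq_zero_iff.mp (congrArg (fun f => f w) h)
  · have h1 := e.toIntertwiningMap.isIntertwining _ _ (θ.symm c) (g w)
    have h2 : e (η.V (θ (θ.symm c)) (g w)) = η'.V (θ.symm c) (e (g w)) := h1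
    rw [θ.apply_symm_apply] at h2
    change e (g _) = _
    rw [hC, h2]
    rfl

end Existence

/-! ### Stabilizers of pieces and conjugation -/

section Conjugation

variable {G : Type w} [Group G]

theorem isPGroup_NBar {p : ℕ} {P : Subgroup G} (hP : IsPGroup p P) (Q : Subgroup G) :
    IsPGroup p (NBar P Q) :=
  (hP.to_le inf_le_right).to_quotient _

theorem barAct_mk (P Q : Subgroup G) (x : NP P Q) (c : Cent Q) :
    ((barAct P Q (QuotientGroup.mk x) c : Cent Q) : G) = x * c * (x : G)⁻¹ := rfl

theorem barAct_mk_inv (P Q : Subgroup G) (x : NP P Q) (c : Cent Q) :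
    (((barAct P Q (QuotientGroup.mk x))⁻¹ c : Cent Q) : G) = (x : G)⁻¹ * c * x := by
  rw [← map_inv, ← QuotientGroup.mk_inv, barAct_mk]
  simp

theorem conj_smul_eq_of_mem_normalizer {Q : Subgroup G} {x : G}
    (hx : x ∈ Subgroup.normalizer (Q : Set G)) : MulAut.conj x • Q = Q := by
  ext g
  rw [Subgroup.mem_pointwise_smul_iff_inv_smul_mem, Subgroup.mem_normalizer_iff''.mp hx g,
    ← map_inv, MulAut.smul_def, MulAut.conj_apply, inv_inv]

theorem mul_mul_inv_mem_NP {P Q : Subgroup G} {x n : G} (hx : x ∈ P) (hn : n ∈ NP P Q) :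
    x * n * x⁻¹ ∈ NP P (MulAut.conj x • Q) := by
  refine Subgroup.mem_inf.mpr ⟨?_, P.mul_mem (P.mul_mem hx hn.2) (P.inv_mem hx)⟩
  rw [Subgroup.mem_normalizer_iff]
  intro g
  simp only [Subgroup.mem_pointwise_smul_iff_inv_smul_mem, ← map_inv, MulAut.smul_def,
    MulAut.conj_apply]
  rw [Subgroup.mem_normalizer_iff.mp hn.1]
  simp [mul_assoc]

/-- Conjugation by `x ∈ P`, from `N_P(Q)` to `N_P(ˣQ)`. -/
def normalizerConj {P : Subgroup G} {x : G} (hx : x ∈ P) (Q : Subgroup G) :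
    NP P Q ≃* NP P (MulAut.conj x • Q) where
  toFun n := ⟨x * n * x⁻¹, mul_mul_inv_mem_NP hx n.2⟩
  invFun n := ⟨x⁻¹ * n * x, by
    have h := mul_mul_inv_mem_NP (P.inv_mem hx) n.2
    rwa [inv_inv, map_inv, inv_smul_smul] at h⟩
  left_inv n := by ext; simp [mul_assoc]
  right_inv n := by ext; simp [mul_assoc]
  map_mul' m n := by ext; simp [mul_assoc]

/-- Conjugation by `x ∈ P`, from `N_P(Q)/Q` to `N_P(ˣQ)/ˣQ`. -/
def barConj {P : Subgroup G} {x : G} (hx : x ∈ P) (Q : Subgroup G) :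
    NBar P Q ≃* NBar P (MulAut.conj x • Q) :=
  QuotientGroup.congr _ _ (normalizerConj hx Q) (by
    ext n
    change n ∈ Subgroup.map (normalizerConj hx Q).toMonoidHom _ ↔ _
    rw [Subgroup.mem_map_equiv, Subgroup.mem_subgroupOf, Subgroup.mem_subgroupOf,
      Subgroup.mem_pointwise_smul_iff_inv_smul_mem, ← map_inv, MulAut.smul_def, MulAut.conj_apply,
      inv_inv]
    rfl)

theorem centConj_barAct {P : Subgroup G} {x : G} (hx : x ∈ P) (Q : Subgroup G) (s : NBar P Q)
    (c : Cent (MulAut.conj x • Q)) :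
    centConj x Q (barAct P _ (barConj hx Q s) c) = barAct P Q s (centConj x Q c) := by
  obtain ⟨n, rfl⟩ := QuotientGroup.mk_surjective s
  ext
  change x⁻¹ * ((x * n * x⁻¹) * c * (x * n * x⁻¹)⁻¹) * x = n * (x⁻¹ * c * x) * (n : G)⁻¹
  group

end Conjugation

section Pieces

variable {p : ℕ} [Fact p.Prime] {F : Type u} {L : Type v} [Field F] [IsAlgClosed F] [CharP F p]
  [Field L] [CharZero L] {ι : CommGroup.torsion Fˣ →* CommGroup.torsion Lˣ}
  {G : Type w} [Group G] [Finite G]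

/-- An element of `N_P(Q)/Q` stabilizes the piece `Q_φ` exactly when it stabilizes the isomorphism
class of `V(φ)`. -/
theorem mem_NBarStab_iff (hι : Function.Injective ι) (P : Subgroup G) (A : Piece p ι G)
    (s : NBar P A.Q) :
    s ∈ NBarStab P A ↔ Nonempty ((twist (barAct P A.Q s) A.φ.V).Equiv A.φ.V) := by
  constructor
  · rintro ⟨x, hx, rfl⟩
    have hxA : (x : G) • A = A := (Subgroup.mem_subgroupOf.mp hx).1
    refine nonempty_equiv_of_brauerChar_eq (p := p) hι (isIrreducible_comp_mulEquiv _ A.φ.V_irreducible)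
      A.φ.V_irreducible (funext fun c => ?_)
    have key : ∀ B : Piece p ι G, B = A → ∃ d : PRegular p (Cent B.Q),
        (d.1 : G) = c.1 ∧ B.φ.1 d = A.φ.1 c := by
      rintro B rfl
      exact ⟨c, rfl, rfl⟩
    obtain ⟨d, hd, h⟩ := key _ hxA
    rw [brauerChar_twist, A.φ.brauerChar_V, ← h]
    refine A.φ_congr ?_
    change (((barAct P A.Q (QuotientGroup.mk x))⁻¹ c.1 : Cent A.Q) : G) = (x : G)⁻¹ * d.1 * x
    rw [barAct_mk_inv, hd]
  · rintro ⟨e⟩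
    obtain ⟨x, rfl⟩ := QuotientGroup.mk_surjective s
    refine ⟨x, Subgroup.mem_subgroupOf.mpr ⟨?_, x.2.2⟩, rfl⟩
    refine Piece.ext' (conj_smul_eq_of_mem_normalizer x.2.1) fun c hA hB oA oB => ?_
    have h := congrFun (brauerChar_congr (p := p) (ι := ι) e) ⟨⟨c, hB⟩, oB⟩
    rw [brauerChar_twist, A.φ.brauerChar_V] at h
    rw [← h]
    refine A.φ_congr ?_
    change (x : G)⁻¹ * c * x =
      (((barAct P A.Q (QuotientGroup.mk x))⁻¹ ⟨c, hB⟩ : Cent A.Q) : G)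
    rw [barAct_mk_inv]

/-- The rank of the norm on `V(φ_{⋊P̄})`, computed for a `P`-conjugate of the piece, is the rank of
the norm on the extension of `V(φ)` to the stabilizer. -/
theorem normRank_barModule (hι : Function.Injective ι) {P : Subgroup G} (hP : IsPGroup p P)
    (X : PrePiece p ι G) (hX : X.P = P) (A : Piece p ι G) {x : G} (hx : x ∈ P)
    (hxA : x • X.piece = A)
    (τ : Representation F (NBarStab P A) (Fin A.φ.dim → F))
    (hτ : ∀ t c v, τ t (A.φ.V c v) = A.φ.V (barAct P A.Q t c) (τ t v)) :
    normRank X.barModule = normRank τ := by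
  obtain ⟨P', hP', B, hB⟩ := X
  obtain rfl : P' = P := hX
  obtain rfl : x • B = A := hxA
  exact normRank_semidirectChar_of_mulEquiv hι (isPGroup_NBar hP B.Q) (centConj x B.Q)
    (barConj hx B.Q) (centConj_barAct hx B.Q) B.φ ((isPGroup_NBar hP (x • B).Q).to_subgroup _)
    (NBarStab P' (x • B)).subtype_injective
    (fun s hs => ⟨⟨s, (mem_NBarStab_iff hι P' (x • B) s).mpr hs⟩, rfl⟩) hτ

end Pieces

end GenPiece

end

theorem proposition3p2 {p : ℕ} [Fact p.Prime]
    {F : Type*} [Field F] [IsAlgClosed F] [CharP F p]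
    {L : Type*} [Field L] [IsAlgClosed L] [CharZero L]
    (ι : CommGroup.torsion Fˣ →* CommGroup.torsion Lˣ) (hι : Function.Injective ι)
    {G : Type*} [Group G] [Finite G]
    (P : Subgroup G) (hP : IsPGroup p P) (A : GenPiece.Piece p ι G) (hA : A.Q ≤ P)
    (S : Subgroup (GenPiece.NBar P A.Q)) (hS : GenPiece.NBarStab P A ≤ S)
    {W : Type*} [AddCommGroup W] [Module F W] [FiniteDimensional F W]
    (V : Representation F
      (GenPiece.Cent A.Q ⋊[(GenPiece.barAct P A.Q).comp S.subtype] S) W)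
    (hV : V.IsIrreducible)
    (hφ : GenPiece.brauerChar p ι V =
      (GenPiece.semidirectChar ((GenPiece.barAct P A.Q).comp S.subtype) A.φ).1) :
    (GenPiece.up P hP A hA).m =
        GenPiece.summandMultiplicity (Representation.leftRegular F S) (GenPiece.resS V) ∧
      ((GenPiece.up P hP A hA).Substantive ↔
        GenPiece.HasNonzeroFreeSummand (GenPiece.resS V)) := by
  have hNB := GenPiece.isPGroup_NBar hP A.Q
  have hT := hNB.to_subgroup (GenPiece.NBarStab P A)
  have hSp := hNB.to_subgroup S
  obtain ⟨τ, hτ⟩ := GenPiece.exists_extension hT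
    ((GenPiece.barAct P A.Q).comp (GenPiece.NBarStab P A).subtype) A.φ.V_irreducible
    fun t => (GenPiece.mem_NBarStab_iff hι P A t).mp t.2
  have hrankS : GenPiece.normRank (GenPiece.resS V) = GenPiece.normRank τ := by
    have := GenPiece.finite_semidirectProduct ((GenPiece.barAct P A.Q).comp S.subtype)
    obtain ⟨e⟩ := GenPiece.nonempty_equiv_of_brauerChar_eq hι hV (GenPiece.Irr.V_irreducible _)
      (hφ.trans (GenPiece.Irr.brauerChar_V _).symm)
    obtain ⟨g, hg, hC⟩ := GenPiece.exists_map_of_liesOver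
      (GenPiece.liesOver_semidirectChar hι hSp ((GenPiece.barAct P A.Q).comp S.subtype) A.φ) e
    exact GenPiece.normRank_resS_eq (j := Subgroup.inclusion hS) hT hτ
      (Subgroup.inclusion_injective hS)
      (fun s hs => ⟨⟨s, (GenPiece.mem_NBarStab_iff hι P A s).mpr hs⟩, rfl⟩)
      A.φ.V_irreducible hV g hg hC
  -- The absolute multiplicity is defined by a representative of the class of `(P, Q_φ)`, which is a
  -- `P`-conjugate of the piece.
  obtain ⟨hXP, x, hx, hxA⟩ := Quotient.mk_out (s := GenPiece.PrePiece.setoid p ι G) ⟨P, hP, A, hA⟩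
  have hrankP : GenPiece.normRank (GenPiece.up P hP A hA).out.barModule = GenPiece.normRank τ :=
    GenPiece.normRank_barModule hι hP _ hXP A (by rwa [hXP] at hx) hxA τ hτ
  have hXp := GenPiece.isPGroup_NBar (GenPiece.up P hP A hA).out.isPGroup
    (GenPiece.up P hP A hA).out.piece.Q
  rw [GenPiece.GeneralizedPiece.m, GenPiece.GeneralizedPiece.Substantive,
    GenPiece.summandMultiplicity_leftRegular hXp,
    GenPiece.summandMultiplicity_leftRegular hSp, GenPiece.hasNonzeroFreeSummand_iff hXp,
    GenPiece.hasNonzeroFreeSummand_iff hSp, hrankS, hrankP]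
  exact ⟨rfl, Iff.rfl⟩
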